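/- **Setting.** Let $X_1,\dots,X_n$ ($n\ge 1$) be i.i.d. with distribution $F$, let $\zeta_1,\dots,\zeta_n$ be i.i.d. with a known Lebesgue density $f_\zeta$ and independent of the $X_j$, and let $Y_j=X_j+\zeta_j$ be observed. Fix $t_0\in\mathbb R$; the target is $F(t_0)$. Write $\hat g(\omega)=\int g(x)e^{i\omega x}\,dx$. For $\alpha>0$, $L>0$ let $\mathcal F_\alpha(L)$ be the set of distributions $F$ with a Lebesgue density $f$ such that $\frac1{2\pi}\int|\hat f(\omega)|^2(1+\omega^2)^\alpha d\omega\le L^2$. For $\epsilon\in(0,1/2)$, an estimator $\tilde F=\tilde F(Y_1,\dots,Y_n)$ and a family $\mathcal F$ of distributions, put $$\mathrm{Risk}_\epsilon[\tilde F;\mathcal F]=\min\Bigl\{\delta:\ \sup_{F\in\mathcal F}P_F\bigl(|\tilde F-F(t_0)|>\delta\bigr)\le\epsilon\Bigr\}.$$ **Assumptions.** (E1) There are $\beta,c_\zeta,C_\zeta>0$ with $c_\zeta(1+\omega^2)^{-\beta/2}\le|\hat f_\zeta(\omega)|\le C_\zeta(1+\omega^2)^{-\beta/2}$ for all $\omega\in\mathbb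 R$. (E2) There are $\omega_0,b_\zeta,\tau>0$ with $|\hat f_\zeta(\omega)|\ge1-b_\zeta|\omega|^\tau$ for $|\omega|\le\omega_0$. **Constants and grid.** Let $\omega_1=\min\{\omega_0,(4b_\zeta)^{-1/\tau}\}$, $c_*=2\pi^{-2}(2+1/\tau)^2$, $$\bar m=\sqrt{2c_*}+(\pi c_\zeta\beta)^{-1}2^{1+(\beta/2-1)_+}\bigl[2+\beta\ln_+(1/\omega_1)\bigr],\qquad \vartheta=\frac{\sqrt2}{\sqrt2-1}\Bigl[1+\sqrt{3\ln(4N\epsilon^{-1})}\Bigr].$$ Let $\Lambda=\{\lambda_1,\dots,\lambda_N\}$, $N\ge1$, with $\lambda_{\min}:=\lambda_1\ge1$, $\lambda_{j+1}\ge2\lambda_j$ for $1\le j<N$ (for instance a dyadic grid), and $$\lambda_{\max}:=\lambda_N=\frac{n}{11\,\bar m^2\ln(4N\epsilon^{-1})}.$$ **Estimator.** For real $y$, $\omega$ put $k_y(\omega)=\omega^{-1}\,\mathrm{Im}\bigl\{e^{i\omega(y-t_0)}/\hat f_\zeta(\omega)\bigr\}$. For $\lambda\in\Lambda$ let $$\tilde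 F_\lambda=\frac12-\frac1n\sum_{j=1}^n\frac1\pi\int_0^\lambda k_{Y_j}(\omega)\,d\omega,\qquad \tilde\sigma_\lambda^2=c_*+\frac{2}{\pi^2n}\sum_{j=1}^n\int_{\omega_1}^\lambda\!\int_{\omega_1}^\lambda k_{Y_j}(\omega)k_{Y_j}(\mu)\,d\omega\,d\mu,$$ $$\tilde v_\lambda^2=\max_{\mu\in\Lambda,\ \mu\le\lambda}\tilde\sigma_\mu^2+11\bar m^2\lambda^{2\beta}n^{-1}\ln(4N^2\epsilon^{-1}),\qquad Q_\lambda=\bigl[\tilde F_\lambda-\vartheta\tilde v_\lambda n^{-1/2},\ \tilde F_\lambda+\vartheta\tilde v_\lambda n^{-1/2}\bigr].$$ Let $\tilde\lambda=\min\{\lambda\in\Lambda:\bigcap_{\mu\in\Lambda,\,\mu\ge\lambda}Q_\mu\ne\varnothing\}$; the adaptive estimator is $\tilde F_{\tilde\lambda}$. **Oracle.** For a distribution $F$ of $X$ and $\lambda\in\Lambda$ let $$\sigma_{\lambda}^2=c_*+\frac2{\pi^2}\,\mathbb E_F\Bigl[\int_{\omega_1}^\lambda k_{Y_1}(\omega)\,d\omega\Bigr]^2,\qquad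 v_{\lambda}^2=\max_{\mu\in\Lambda,\ \mu\le\lambda}\sigma_{\mu}^2+11\bar m^2\lambda^{2\beta}n^{-1}\ln(4N^2\epsilon^{-1}),$$ $$\lambda_o=\lambda_o(\alpha,L)=\min\bigl\{\lambda\in\Lambda:\ v_{\lambda}n^{-1/2}\ge2\sqrt2\,\pi^{-1/2}L\lambda^{-\alpha-1/2}\bigr\};$$ $\lambda_o$ exists, and then $\lambda_{\min}\le\lambda_o\le\lambda_{\max}$, if and only if this set is nonempty. The quantities $v_\lambda$ and $\lambda_o$ depend on $F$ through $\mathbb E_F$; write $v_{\lambda_o}(F)$ for the resulting value. **Theorem.** Assume (E1), (E2) and $\beta>1/2$, and let $\alpha>0$, $L>0$. For every $F\in\mathcal F_\alpha(L)$ for which $\lambda_o$ exists, $$\mathrm{Risk}_\epsilon[\tilde F_{\tilde\lambda};\{F\}]\le\Bigl(3-\frac1{\sqrt2}\Bigr)\vartheta\,v_{\lambda_o}(F)\,n^{-1/2}.$$ Consequently, if $\lambda_o$ exists for every $F\in\mathcal F_\alpha(L)$, then $$\mathrm{Risk}_\epsilon[\tilde F_{\tilde\lambda};\mathcal F_\alpha(L)]\le\Bigl(3-\frac1{\sqrt2}\Bigr)\vartheta\,n^{-1/2}\sup_{F\in\mathcal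 F_\alpha(L)}v_{\lambda_o}(F).$$ -/

import Mathlib

open MeasureTheory ProbabilityTheory
open scoped ENNReal

noncomputable section

namespace Deconv

/-- The law of the measurement error together with the numerical constants that occur in the
two assumptions on it.  The characteristic function of the error is `charFun E.law`, that is,
`ω ↦ ∫ x, exp (i ω x) ∂(E.law)`. -/
structure ErrorModel where
  law : Measure ℝ
  β : ℝ
  cζ : ℝ
  Cζ : ℝ
  ω₀ : ℝ
  bζ : ℝ
  τ : ℝ

/-- Ordinary smooth errors: the characteristic function decays exactly like `|ω|^(-β)`. -/
def ErrorModel.OrdinarySmooth (E : ErrorModel) : Prop :=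
  0 < E.β ∧ 0 < E.cζ ∧ 0 < E.Cζ ∧
    ∀ ω : ℝ, E.cζ * (1 + ω ^ 2) ^ (-E.β / 2) ≤ ‖charFun E.law ω‖ ∧
      ‖charFun E.law ω‖ ≤ E.Cζ * (1 + ω ^ 2) ^ (-E.β / 2)

/-- Local behaviour of the characteristic function of the error near the origin. -/
def ErrorModel.LocalBound (E : ErrorModel) : Prop :=
  0 < E.ω₀ ∧ 0 < E.bζ ∧ 0 < E.τ ∧
    ∀ ω : ℝ, |ω| ≤ E.ω₀ → 1 - E.bζ * |ω| ^ E.τ ≤ ‖charFun E.law ω‖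

/-- The Sobolev class `F_α(L)`: probability distributions on the line that have a density with
respect to Lebesgue measure and satisfy `(2π)⁻¹ ∫ |f̂(ω)|² (1 + ω²)^α dω ≤ L²`.  The Fourier
transform `f̂(ω) = ∫ f(x) exp (i ω x) dx` of the density is the characteristic function. -/
def sobolevClass (α L : ℝ) : Set (Measure ℝ) :=
  {F | IsProbabilityMeasure F ∧ F ≪ volume ∧
    ENNReal.ofReal (1 / (2 * Real.pi)) *
      ∫⁻ ω : ℝ, ENNReal.ofReal (‖charFun F ω‖ ^ 2 * (1 + ω ^ 2) ^ α) ≤ ENNReal.ofReal (L ^ 2)}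

/-- The law of one observation `Y = X + ζ`, where `X ∼ F` and the error `ζ` are independent. -/
def obsLaw (E : ErrorModel) (F : Measure ℝ) : Measure ℝ := Measure.conv F E.law

/-- The law of the sample `(Y₁, …, Yₙ)` of independent observations. -/
def sampleLaw (E : ErrorModel) (n : ℕ) (F : Measure ℝ) : Measure (Fin n → ℝ) :=
  Measure.pi fun _ => obsLaw E F

/-- The `ε`-risk over the family `𝓕` of an estimator `est` of `F(t₀)`: the least `δ` such that
`sup_{F ∈ 𝓕} P_F (|est - F(t₀)| > δ) ≤ ε`. -/
def epsRisk (E : ErrorModel) {n : ℕ} (t₀ ε : ℝ) (est : (Fin n → ℝ) → ℝ)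
    (𝓕 : Set (Measure ℝ)) : ℝ≥0∞ :=
  sInf {δ : ℝ≥0∞ |
    ⨆ F ∈ 𝓕, sampleLaw E n F {y | δ < ENNReal.ofReal |est y - cdf F t₀|} ≤ ENNReal.ofReal ε}

/-- `ω⁻¹ Im (exp (i ω (y - t₀)) / f̂_ζ(ω))`. -/
def kern (E : ErrorModel) (t₀ y ω : ℝ) : ℝ :=
  ω⁻¹ * (Complex.exp (Complex.I * ω * (y - t₀)) / charFun E.law ω).im

/-- The estimator of `F(t₀)` with bandwidth parameter `l`. -/
def cdfEst (E : ErrorModel) {n : ℕ} (t₀ l : ℝ) (y : Fin n → ℝ) : ℝ :=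
  1 / 2 - (1 / (n : ℝ)) * ∑ j, (1 / Real.pi) * ∫ ω in (0 : ℝ)..l, kern E t₀ (y j) ω

def omegaOne (E : ErrorModel) : ℝ := min E.ω₀ ((4 * E.bζ) ^ (-(1 / E.τ)))

def cStar (E : ErrorModel) : ℝ := 2 / Real.pi ^ 2 * (2 + 1 / E.τ) ^ 2

def mBar (E : ErrorModel) : ℝ :=
  √(2 * cStar E) + (Real.pi * E.cζ * E.β)⁻¹ * 2 ^ (1 + max (E.β / 2 - 1) 0) *
    (2 + E.β * max (Real.log (1 / omegaOne E)) 0)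

def vartheta (N : ℕ) (ε : ℝ) : ℝ :=
  √2 * (√2 - 1)⁻¹ * (1 + √(3 * Real.log (4 * N / ε)))

/-- The largest bandwidth parameter. -/
def lamMax (E : ErrorModel) (n N : ℕ) (ε : ℝ) : ℝ :=
  (11 * mBar E ^ 2 * Real.log (4 * N / ε))⁻¹ * n

/-- The grid `{l₁, …, l_N}`. -/
def grid (N : ℕ) (lam : ℕ → ℝ) : Set ℝ := lam '' Set.Icc 1 N

/-- The data-driven quantity `σ̃_l²`. -/
def sigmaTildeSq (E : ErrorModel) {n : ℕ} (t₀ : ℝ) (y : Fin n → ℝ) (l : ℝ) : ℝ :=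
  cStar E + 2 / (Real.pi ^ 2 * n) *
    ∑ j, ∫ ω in omegaOne E..l, ∫ μ in omegaOne E..l, kern E t₀ (y j) ω * kern E t₀ (y j) μ

/-- The quantity `σ_l²` when the distribution of `X` is `F`. -/
def sigmaSq (E : ErrorModel) (t₀ : ℝ) (F : Measure ℝ) (l : ℝ) : ℝ :=
  cStar E + 2 / Real.pi ^ 2 * ∫ y, (∫ ω in omegaOne E..l, kern E t₀ y ω) ^ 2 ∂(obsLaw E F)

/-- The maximum of `g μ` over the grid points `μ ≤ l` (a finite set, nonempty for grid
points `l`). -/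
def gridMax (Λ : Set ℝ) (g : ℝ → ℝ) (l : ℝ) : ℝ := sSup (g '' {μ | μ ∈ Λ ∧ μ ≤ l})

/-- The deterministic term `11 m̄² l^(2β) n⁻¹ ln (4 N² / ε)`. -/
def penalty (E : ErrorModel) (n N : ℕ) (ε l : ℝ) : ℝ :=
  11 * mBar E ^ 2 * l ^ (2 * E.β) * (n : ℝ)⁻¹ * Real.log (4 * (N : ℝ) ^ 2 / ε)

/-- The data-driven `ṽ_l`. -/
def vTilde (E : ErrorModel) {n : ℕ} (N : ℕ) (ε t₀ : ℝ) (Λ : Set ℝ) (y : Fin n → ℝ)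
    (l : ℝ) : ℝ :=
  √(gridMax Λ (sigmaTildeSq E t₀ y) l + penalty E n N ε l)

/-- The quantity `v_l` when the distribution of `X` is `F`. -/
def vOracle (E : ErrorModel) (n N : ℕ) (ε t₀ : ℝ) (Λ : Set ℝ) (F : Measure ℝ) (l : ℝ) : ℝ :=
  √(gridMax Λ (sigmaSq E t₀ F) l + penalty E n N ε l)

/-- The interval `Q_l`. -/
def confInt (E : ErrorModel) {n : ℕ} (N : ℕ) (ε t₀ : ℝ) (Λ : Set ℝ) (y : Fin n → ℝ)
    (l : ℝ) : Set ℝ :=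
  Set.Icc (cdfEst E t₀ l y - vartheta N ε * vTilde E N ε t₀ Λ y l * (√(n : ℝ))⁻¹)
    (cdfEst E t₀ l y + vartheta N ε * vTilde E N ε t₀ Λ y l * (√(n : ℝ))⁻¹)

/-- The selected bandwidth: the least grid point `l` such that the intervals `Q_μ` with
`μ ≥ l` in the grid have a common point.  The set is finite, and it contains the largest grid
point, so that the infimum is a minimum. -/
def lamTilde (E : ErrorModel) {n : ℕ} (N : ℕ) (ε t₀ : ℝ) (Λ : Set ℝ) (y : Fin n → ℝ) : ℝ :=
  sInf {l | l ∈ Λ ∧ (⋂ μ ∈ {μ | μ ∈ Λ ∧ l ≤ μ}, confInt E N ε t₀ Λ y μ).Nonempty}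

/-- The adaptive estimator. -/
def adaptiveEst (E : ErrorModel) {n : ℕ} (N : ℕ) (ε t₀ : ℝ) (Λ : Set ℝ) (y : Fin n → ℝ) : ℝ :=
  cdfEst E t₀ (lamTilde E N ε t₀ Λ y) y

/-- `l` is the oracle bandwidth `l_o(α, L)`, that is, the least grid point at which `v_l n^(-1/2)`
dominates `2 √2 π^(-1/2) L l^(-α-1/2)`; the distribution of `X` is `F`. -/
def IsOracle (E : ErrorModel) (n N : ℕ) (ε t₀ : ℝ) (Λ : Set ℝ) (α L : ℝ) (F : Measure ℝ)
    (l : ℝ) : Prop :=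
  IsLeast {l | l ∈ Λ ∧ 2 * √2 * (√Real.pi)⁻¹ * L * l ^ (-α - 1 / 2) ≤
    vOracle E n N ε t₀ Λ F l * (√(n : ℝ))⁻¹} l

/-- The bound `(3 - 1/√2) ϑ v_l n^(-1/2)`. -/
def riskBound (E : ErrorModel) (n N : ℕ) (ε t₀ : ℝ) (Λ : Set ℝ) (F : Measure ℝ) (l : ℝ) : ℝ :=
  (3 - 1 / √2) * vartheta N ε * vOracle E n N ε t₀ Λ F l * (√(n : ℝ))⁻¹

end Deconv

end

open scoped Topology

namespace Deconv

variable {E : ErrorModel}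

/-! The argument is a Lepski-type comparison of confidence intervals on one favourable event.

Probability enters only through Bernstein's inequality (`bernstein_mean`), applied at every grid
point to the estimator and to the empirical variance. With level $u=\ln(4N/\epsilon)$ a union bound
gives an event of probability at least $1-\epsilon$ (`sampleLaw_not_isGood_le`) on which all these
deviations are controlled. The rest is deterministic.

The inputs to Bernstein are bounds on the contribution of one observation. Above $\omega_1$ the
decay of the error's characteristic function gives order $\lambda^\beta$. Below $\omega_1$ the
factor $1/\omega$ is not absolutely integrable; there the kernel is an average of
$\omega^{-1}\sin(\omega(y-t_0-z))$ over the error law, up to a factor close to 1, and the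
boundedness of the sine integral yields the constant $2+1/\tau$ behind $c_*$.

For the bias, averaging the kernel over the observations cancels $\hat f_\zeta$, so the mean of the
estimator is Gil-Pelaez inversion truncated at $\lambda$. The missing tail is controlled by the
Sobolev condition (`abs_cdf_sub_le`). It is at most half the threshold defining $\lambda_o$; since
the bias bound decreases in $\lambda$ and $v_\lambda$ increases, the bias is at most $v_\lambda
n^{-1/2}/2$ for all $\lambda\ge\lambda_o$.

Hence on the favourable event $F(t_0)\in Q_\mu$ for every grid point $\mu\ge\lambda_o$, which forces
$\tilde\lambda\le\lambda_o$. The intervals at $\tilde\lambda$ and $\lambda_o$ then share a point, so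
the two estimators differ by at most $\vartheta(\tilde v_{\tilde\lambda}+\tilde
v_{\lambda_o})n^{-1/2}$. If $\tilde\lambda<\lambda_o$, the grid ratio 2 and $\beta>1/2$ halve the
penalty at $\tilde\lambda$; this gain pays for replacing the empirical $\tilde v$ by $v_{\lambda_o}$
(`two_intervals_le`). The constant arises from $(3-1/\sqrt2)(2+\sqrt2)=2(2+\sqrt2)+1$: two
half-widths plus the error of the oracle estimator. -/

/-! ### Bernstein's inequality. -/

/-- Since $(n+2)!\ge 2\cdot3^n$, the exponential series from the quadratic term on is dominated by a
geometric series of ratio $y/3$. -/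
lemma exp_le_quadratic {x y : ℝ} (hxy : |x| ≤ y) (hy : y < 3) :
    Real.exp x ≤ 1 + x + x ^ 2 / (2 * (1 - y / 3)) := by
  have hy0 : 0 ≤ y := (abs_nonneg x).trans hxy
  have h1 : HasSum (fun n : ℕ => x ^ n / n.factorial) (Real.exp x) := by
    rw [Real.exp_eq_exp_ℝ]
    exact NormedSpace.expSeries_div_hasSum_exp x
  have h2 := (hasSum_nat_add_iff' 2).2 h1
  have h3 : HasSum (fun n : ℕ => x ^ 2 / 2 * (y / 3) ^ n) (x ^ 2 / 2 * (1 - y / 3)⁻¹) :=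
    (hasSum_geometric_of_lt_one (by positivity) (by linarith)).mul_left _
  have h4 := hasSum_le (fun n => ?_) h2 h3
  · simp [Finset.sum_range_succ] at h4
    have : x ^ 2 / (2 * (1 - y / 3)) = x ^ 2 / 2 * (1 - y / 3)⁻¹ := by
      rw [← div_div, div_eq_mul_inv (x ^ 2 / 2)]
    linarith
  · have hf : (2 * 3 ^ n : ℝ) ≤ ((n + 2).factorial : ℝ) := by
      exact_mod_cast (by
        have := Nat.factorial_mul_pow_le_factorial (m := 2) (n := n)
        simpa [add_comm] using this)
    have hx : x ^ n ≤ y ^ n :=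
      (le_abs_self _).trans (by rw [abs_pow]; exact pow_le_pow_left₀ (abs_nonneg x) hxy n)
    calc x ^ (n + 2) / ((n + 2).factorial : ℝ) = x ^ 2 * x ^ n / ((n + 2).factorial : ℝ) := by
          rw [pow_add, mul_comm]
      _ ≤ x ^ 2 * y ^ n / ((n + 2).factorial : ℝ) := by gcongr
      _ ≤ x ^ 2 * y ^ n / (2 * 3 ^ n) := by gcongr
      _ = _ := by rw [div_pow]; field_simp

/-- Bernstein's inequality in the form of a deviation bound at confidence level `exp (-u)`. -/
theorem bernstein_upper {Ω : Type*} [MeasurableSpace Ω] (P : Measure Ω) [IsProbabilityMeasure P]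
    {n : ℕ} (hn : 1 ≤ n) {Z : Ω → ℝ} (hZ : Measurable Z) {M V u : ℝ} (hM : ∀ x, |Z x| ≤ M)
    (hZ0 : ∫ x, Z x ∂P = 0) (hV : 0 < V) (hZV : ∫ x, Z x ^ 2 ∂P ≤ V) (hu : 0 < u) :
    (Measure.pi fun _ : Fin n => P) {y | √(2 * n * V * u) + M * u / 3 ≤ ∑ j, Z (y j)} ≤
      ENNReal.ofReal (Real.exp (-u)) := by
  obtain ⟨x₀⟩ : Nonempty Ω := nonempty_of_isProbabilityMeasure P
  have hM0 : 0 ≤ M := (abs_nonneg _).trans (hM x₀)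
  have hn0 : (0 : ℝ) < n := by exact_mod_cast hn
  -- The Chernoff parameter $t=r/(1+Mr/3)$ makes $1-tM/3=(1+Mr/3)^{-1}$, and then the exponent
  -- collapses to exactly $-u$.
  set r := √(2 * u / (n * V)) with hr
  have hr0 : 0 < r := Real.sqrt_pos.2 (by positivity)
  have hr2 : r ^ 2 = 2 * u / (n * V) := Real.sq_sqrt (by positivity)
  set q := √(2 * n * V * u) with hq
  have hrq : r * q = 2 * u := by
    rw [hr, hq, ← Real.sqrt_mul (by positivity), show 2 * u / (n * V) * (2 * n * V * u) =
      (2 * u) ^ 2 by field_simp]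
    exact Real.sqrt_sq (by positivity)
  set t := r / (1 + M / 3 * r) with ht
  have hd : 0 < 1 + M / 3 * r := by positivity
  have ht0 : 0 < t := by positivity
  have htM : 1 - t * M / 3 = (1 + M / 3 * r)⁻¹ := by
    rw [ht]; field_simp; ring
  have htM3 : t * M < 3 := by
    have : 0 < (1 + M / 3 * r)⁻¹ := by positivity
    linarith
  have hbd : ∀ x, |t * Z x| ≤ t * M := fun x => by
    rw [abs_mul, abs_of_pos ht0]; gcongr; exact hM x
  have hZi : Integrable Z P := Integrable.of_bound hZ.aestronglyMeasurable M
    (ae_of_all _ fun x => by simpa using hM x)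
  have hZ2i : Integrable (fun x => Z x ^ 2) P :=
    Integrable.of_bound (hZ.pow_const 2).aestronglyMeasurable (M ^ 2)
      (ae_of_all _ fun x => by simpa using pow_le_pow_left₀ (abs_nonneg _) (hM x) 2)
  have hei : Integrable (fun x => Real.exp (t * Z x)) P :=
    Integrable.of_bound (by fun_prop) (Real.exp (t * M)) (ae_of_all _ fun x => by
      simpa using (le_abs_self _).trans (hbd x))
  set w := (n : ℝ)⁻¹ * (u * (1 + M / 3 * r)⁻¹) with hw
  have hmgf : ∫ x, Real.exp (t * Z x) ∂P ≤ Real.exp w := by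
    calc ∫ x, Real.exp (t * Z x) ∂P
        ≤ ∫ x, (1 + t * Z x + (t ^ 2 / (2 * (1 - t * M / 3))) * Z x ^ 2) ∂P := by
          refine integral_mono hei (by fun_prop) fun x => ?_
          refine (exp_le_quadratic (hbd x) htM3).trans_eq ?_
          ring
      _ = 1 + (t ^ 2 / (2 * (1 - t * M / 3))) * ∫ x, Z x ^ 2 ∂P := by
          rw [integral_add (by fun_prop) (by fun_prop), integral_add (by fun_prop) (by fun_prop),
            integral_const_mul, integral_const_mul, hZ0]
          simp
      _ ≤ 1 + (t ^ 2 / (2 * (1 - t * M / 3))) * V := by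
          have : 0 ≤ t ^ 2 / (2 * (1 - t * M / 3)) := by rw [htM]; positivity
          gcongr
      _ = 1 + w := by
          rw [htM, ht, hw, div_pow, hr2]; field_simp
      _ ≤ Real.exp w := by linarith [Real.add_one_le_exp w]
  have hpi : (fun y : Fin n → Ω => Real.exp (t * ∑ j, Z (y j))) =
      fun y => ∏ j, Real.exp (t * Z (y j)) := by
    ext y; rw [Finset.mul_sum, Real.exp_sum]
  have hint : Integrable (fun y : Fin n → Ω => Real.exp (t * ∑ j, Z (y j)))
      (Measure.pi fun _ : Fin n => P) := by
    rw [hpi]; exact Integrable.fintype_prod (fun _ => hei)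
  have hch := measure_ge_le_exp_mul_mgf (μ := Measure.pi fun _ : Fin n => P)
    (X := fun y => ∑ j, Z (y j)) (q + M * u / 3) ht0.le hint
  have hfin : (Measure.pi fun _ : Fin n => P).real {y | q + M * u / 3 ≤ ∑ j, Z (y j)} ≤
      Real.exp (-u) := by
    refine hch.trans ?_
    rw [mgf, hpi, integral_fintype_prod_eq_pow (fun x => Real.exp (t * Z x))]
    simp only [Fintype.card_fin]
    calc _ ≤ Real.exp (-t * (q + M * u / 3)) * Real.exp w ^ n := by
          gcongr
      _ = Real.exp (-u) := by
          rw [← Real.exp_nat_mul, ← Real.exp_add]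
          congr 1
          have h1 : t * (q + M * u / 3) = (2 * u + M / 3 * r * u) * (1 + M / 3 * r)⁻¹ := by
            rw [← hrq, ht]; field_simp
          have h2 : (n : ℝ) * w = u * (1 + M / 3 * r)⁻¹ := by rw [hw]; field_simp
          rw [neg_mul, h1, h2]
          field_simp
          ring
  rw [← ENNReal.ofReal_toReal (measure_ne_top (Measure.pi fun _ : Fin n => P) _)]
  exact ENNReal.ofReal_le_ofReal hfin

/-- Two-sided Bernstein inequality for the centred empirical mean of a bounded function. -/
theorem bernstein_mean {Ω : Type*} [MeasurableSpace Ω] (P : Measure Ω) [IsProbabilityMeasure P]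
    {n : ℕ} (hn : 1 ≤ n) {f : Ω → ℝ} (hf : Measurable f) {M V u : ℝ}
    (hM : ∀ x, |f x - ∫ x, f x ∂P| ≤ M) (hfi : Integrable f P) (hf2 : Integrable (fun x => f x ^ 2) P)
    (hV : 0 < V) (hfV : ∫ x, f x ^ 2 ∂P ≤ V) (hu : 0 < u) :
    (Measure.pi fun _ : Fin n => P) {y | √(2 * V * u / n) + M * u / (3 * n) <
      |(n : ℝ)⁻¹ * ∑ j, f (y j) - ∫ x, f x ∂P|} ≤ ENNReal.ofReal (2 * Real.exp (-u)) := by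
  have hn0 : (0 : ℝ) < n := by exact_mod_cast hn
  set m := ∫ x, f x ∂P with hm
  have hc : ∫ x, (f x - m) ∂P = 0 := by
    rw [integral_sub hfi (by fun_prop)]; simp [hm]
  -- The variance is at most the second moment, so a bound on the latter suffices.
  have hv : ∫ x, (f x - m) ^ 2 ∂P ≤ V := by
    have : ∫ x, (f x - m) ^ 2 ∂P = ∫ x, f x ^ 2 ∂P - m ^ 2 := by
      have h1 : ∀ x, (f x - m) ^ 2 = f x ^ 2 - (2 * m) * f x + m ^ 2 := fun x => by ring
      simp_rw [h1]
      rw [integral_add (by fun_prop) (by fun_prop), integral_sub (by fun_prop) (by fun_prop),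
        integral_const_mul, ← hm]
      simp; ring
    nlinarith [sq_nonneg m]
  have h1 := bernstein_upper P hn (Z := fun x => f x - m) (by fun_prop) hM hc hV hv hu
  have h2 := bernstein_upper P hn (Z := fun x => -(f x - m)) (by fun_prop)
    (by simpa only [abs_neg] using hM) (by rw [integral_neg, hc, neg_zero]) hV
    (by simpa only [neg_sq] using hv) hu
  have hs : √(2 * n * V * u) = n * √(2 * V * u / n) := by
    rw [show 2 * n * V * u = n ^ 2 * (2 * V * u / n) by field_simp,
      Real.sqrt_mul (by positivity), Real.sqrt_sq hn0.le]
  have hsum : ∀ y : Fin n → Ω, ∑ j, (f (y j) - m) = n * ((n : ℝ)⁻¹ * ∑ j, f (y j) - m) := by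
    intro y
    rw [Finset.sum_sub_distrib]; simp; field_simp
  rw [two_mul (Real.exp (-u)), ENNReal.ofReal_add (Real.exp_pos _).le (Real.exp_pos _).le]
  refine (measure_mono ?_).trans ((measure_union_le _ _).trans (add_le_add h1 h2))
  intro y hy
  simp only [Set.mem_ofPred_eq, Set.mem_union] at hy ⊢
  have hk : √(2 * n * V * u) + M * u / 3 = n * (√(2 * V * u / n) + M * u / (3 * n)) := by
    rw [hs]; field_simp
  rw [Finset.sum_neg_distrib, hsum, hk]
  rcases lt_abs.1 hy with h | h
  · left; gcongr
  · right; rw [← mul_neg]; gcongr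

/-! ### Numerical inequalities behind the constants of the theorem. -/

lemma sqrt_two_bounds : 1.4142 < √2 ∧ √2 < 1.4143 :=
  ⟨Real.lt_sqrt_of_sq_lt (by norm_num), (Real.sqrt_lt' (by norm_num)).2 (by norm_num)⟩

lemma sqrt_three_bounds : 1.732 < √3 ∧ √3 < 1.7321 :=
  ⟨Real.lt_sqrt_of_sq_lt (by norm_num), (Real.sqrt_lt' (by norm_num)).2 (by norm_num)⟩

lemma sqrt_two_div_sub_one : √2 * (√2 - 1)⁻¹ = 2 + √2 := by
  have h := sqrt_two_bounds.1
  have h2 : √2 * √2 = 2 := Real.mul_self_sqrt (by norm_num)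
  rw [← div_eq_mul_inv, div_eq_iff (by linarith)]
  linarith

/-- Here and below $t^2$ stands for the maximal variance, $d$ for the deviation scale, `pen` for the
penalty and $w$ for $\sqrt u$. By Cauchy–Schwarz it is enough that $2+(4/9)/44\le3$; the term $v/2$
is the share of the bias. -/
lemma stochastic_error_le {t d v pen w : ℝ} (ht : 0 ≤ t) (hv : 0 ≤ v) (hw : 0 ≤ w)
    (hpen : 44 * d ^ 2 ≤ pen) (hv2 : v ^ 2 = t ^ 2 + pen) :
    w * (√2 * t + 2 / 3 * d) + v / 2 ≤ (1 + √3 * w) * v := by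
  obtain ⟨h2, h2'⟩ := sqrt_two_bounds
  obtain ⟨h3, h3'⟩ := sqrt_three_bounds
  have h : √2 * t + 2 / 3 * d ≤ √3 * v := by
    have : 1.4143 * t + 2 / 3 * d ≤ 1.732 * v := by
      refine abs_le_of_sq_le_sq' ?_ (by positivity) |>.2
      nlinarith [sq_nonneg (t - 20 * d)]
    nlinarith
  nlinarith

lemma le_vartheta_mul_of_sq_ge {t d v v' pen w : ℝ}
    (hv' : 0 ≤ v') (hw : 0 ≤ w) (hpen : 44 * d ^ 2 ≤ pen) (hv2 : v ^ 2 = t ^ 2 + pen)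
    (hv'2 : t ^ 2 - (2 * d * t + 2 / 3 * d ^ 2) + pen ≤ v' ^ 2) :
    (1 + √3 * w) * v ≤ √2 * (√2 - 1)⁻¹ * (1 + √3 * w) * v' := by
  have h : v ≤ 2 * v' := by
    refine abs_le_of_sq_le_sq' ?_ (by positivity) |>.2
    nlinarith [sq_nonneg (t - 2 * d)]
  rw [sqrt_two_div_sub_one]
  have h3 : 0 ≤ √3 * w := by positivity
  have : v ≤ (2 + √2) * v' := by nlinarith [Real.sqrt_nonneg 2]
  nlinarith

/-- The first square absorbs the products with $v$, the second the product $td$; part of $v^2$ is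
spent through the hypothesis. -/
lemma indefinite_form_le {t d v : ℝ} (h : t ^ 2 + 44 * d ^ 2 ≤ v ^ 2) :
    20.2 * (t * d) - 124 * d ^ 2 + 2 * (1.4143 * (v * t) + 2 / 3 * (v * d)) ≤
      2 * (1.732 * v ^ 2) := by
  have h1 := sq_nonneg (v - 0.966 * t - 0.455 * d)
  have h2 := sq_nonneg (t - 17.5 * d)
  linarith [sq_nonneg d, sq_nonneg t, sq_nonneg (v - t), sq_nonneg (v - d), sq_nonneg (t - d)]

/-- The index 1 belongs to a selected bandwidth below the oracle, whose penalty is halved and whose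
deviation scale is smaller by $\sqrt2$; the index 2 belongs to the oracle itself. The excess of
$v_1+v_2$ over $2v$ must fit into the slack left by `stochastic_error_le`. -/
lemma two_intervals_le {t d v v₁ v₂ pen w : ℝ} (ht : 0 ≤ t) (hd : 0 ≤ d) (hv : 0 < v)
    (hw : 0 ≤ w) (hpen : 44 * d ^ 2 ≤ pen) (hv2 : v ^ 2 = t ^ 2 + pen)
    (h₁ : v₁ ^ 2 ≤ t ^ 2 + (√2 * d * t + 1 / 3 * d ^ 2) + pen / 2)
    (h₂ : v₂ ^ 2 ≤ t ^ 2 + (2 * d * t + 2 / 3 * d ^ 2) + pen) :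
    √2 * (√2 - 1)⁻¹ * (1 + √3 * w) * (v₁ + v₂) + (w * (√2 * t + 2 / 3 * d) + v / 2) ≤
      (3 - 1 / √2) * (√2 * (√2 - 1)⁻¹ * (1 + √3 * w)) * v := by
  obtain ⟨h2, h2'⟩ := sqrt_two_bounds
  obtain ⟨h3, h3'⟩ := sqrt_three_bounds
  have h22 : √2 * √2 = 2 := Real.mul_self_sqrt (by norm_num)
  have hinv : 1 / √2 = √2 / 2 := by
    rw [div_eq_div_iff (by positivity) (by norm_num)]; linarith
  rw [sqrt_two_div_sub_one, hinv]
  set a := √2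
  set b := √3
  set H := (2 + a) * t * d - 21 * d ^ 2 with hH
  have htd : 0 ≤ t * d := by positivity
  have hvv : t ^ 2 + 44 * d ^ 2 ≤ v ^ 2 := by linarith
  -- From $2vv_i\le v_i^2+v^2$. The halved penalty contributes $-\mathrm{pen}/2\le-22d^2$ against
  -- $+d^2$, hence the 21 in $H$.
  have hsum : 2 * v * (v₁ + v₂ - 2 * v) ≤ H := by
    nlinarith [sq_nonneg (v₁ - v), sq_nonneg (v₂ - v)]
  have hc0 : (2 + a) * (2 + a) ≤ 11.66 :=
    (mul_self_le_mul_self (by linarith) (by linarith : 2 + a ≤ 3.4143)).trans (by norm_num)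
  have hc3 : 5.913 ≤ (2 + a) * b :=
    le_trans (by norm_num) (mul_le_mul (by linarith : (3.4142 : ℝ) ≤ 2 + a) h3.le (by norm_num)
      (by linarith))
  have hc2 : (2 + a) * (2 + a) * b ≤ 20.2 :=
    (mul_le_mul hc0 h3'.le (by positivity) (by norm_num)).trans (by norm_num)
  have hi : (2 + a) * H ≤ v ^ 2 := by
    have e : (2 + a) * H = ((2 + a) * (2 + a)) * (t * d) - (21 * (2 + a)) * d ^ 2 := by
      rw [hH]; ring
    have e1 : ((2 + a) * (2 + a)) * (t * d) ≤ 11.66 * (t * d) := by gcongr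
    have e2 : 71 * d ^ 2 ≤ (21 * (2 + a)) * d ^ 2 := by gcongr; linarith
    have e3 := sq_nonneg (t - 5.83 * d)
    linarith [sq_nonneg d]
  have hii : (2 + a) * b * H ≤ 2 * v * (b * v - a * t - 2 / 3 * d) := by
    have e : (2 + a) * b * H = ((2 + a) * (2 + a) * b) * (t * d) -
      (21 * ((2 + a) * b)) * d ^ 2 := by rw [hH]; ring
    have e1 : ((2 + a) * (2 + a) * b) * (t * d) ≤ 20.2 * (t * d) := by gcongr
    have e2 : 124 * d ^ 2 ≤ (21 * ((2 + a) * b)) * d ^ 2 := by gcongr; linarith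
    have e3 : 1.732 * v ^ 2 ≤ b * v ^ 2 := by gcongr
    have e4 : a * (v * t) ≤ 1.4143 * (v * t) := by gcongr
    have e5 := indefinite_form_le hvv
    linarith
  -- The inequality is affine in $w$: `hi` settles the constant term and `hii` the coefficient of
  -- $w$.
  have hkey : (2 + a) * (1 + b * w) * (v₁ + v₂ - 2 * v) ≤
      v / 2 + w * (b * v - a * t - 2 / 3 * d) := by
    have h5 : (2 + a) * (1 + b * w) * (2 * v * (v₁ + v₂ - 2 * v)) ≤ (2 + a) * (1 + b * w) * H := by
      gcongr
    have h6 : 2 * v * ((2 + a) * (1 + b * w) * (v₁ + v₂ - 2 * v)) ≤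
        2 * v * (v / 2 + w * (b * v - a * t - 2 / 3 * d)) := by
      have h7 := mul_le_mul_of_nonneg_left hii hw
      linarith
    exact le_of_mul_le_mul_left h6 (by positivity)
  have e3 : (3 - a / 2) * ((2 + a) * (1 + b * w)) * v =
      (2 + a) * (1 + b * w) * (2 * v) + (1 + b * w) * v := by
    have : (3 - a / 2) * (2 + a) = 2 * (2 + a) + 1 := by linarith
    calc _ = ((3 - a / 2) * (2 + a)) * ((1 + b * w) * v) := by ring
      _ = _ := by rw [this]; ring
  rw [e3]
  linarith

/-! ### The sine integral: convergence rate and bounds. -/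

/-- The sine integral. -/
noncomputable def sineInt (A : ℝ) : ℝ := ∫ u in (0 : ℝ)..A, Real.sinc u

lemma intervalIntegrable_sinc (a b : ℝ) : IntervalIntegrable Real.sinc volume a b :=
  Real.continuous_sinc.intervalIntegrable a b

lemma sineInt_zero : sineInt 0 = 0 := intervalIntegral.integral_same

lemma sineInt_neg (A : ℝ) : sineInt (-A) = -sineInt A := by
  have h := intervalIntegral.integral_comp_neg (a := 0) (b := A) Real.sinc
  simp only [Real.sinc_neg, neg_zero] at h
  rw [sineInt, sineInt, h, intervalIntegral.integral_symm]

lemma continuous_sineInt : Continuous sineInt :=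
  intervalIntegral.continuous_primitive (fun a b => intervalIntegrable_sinc a b) 0

lemma integral_sin_mul_exp (A s : ℝ) :
    ∫ x in (0 : ℝ)..A, Real.sin x * Real.exp (-s * x) =
      (1 - Real.exp (-s * A) * (Real.cos A + s * Real.sin A)) / (1 + s ^ 2) := by
  have hs : (1 + s ^ 2) ≠ 0 := by positivity
  have h := intervalIntegral.integral_eq_sub_of_hasDerivAt (a := 0) (b := A)
    (f := fun x => -(Real.exp (-s * x) * (Real.cos x + s * Real.sin x)) / (1 + s ^ 2))
    (f' := fun x => Real.sin x * Real.exp (-s * x)) (fun x _ => ?_)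
    (Continuous.intervalIntegrable (by fun_prop) _ _)
  · rw [h]; simp; field_simp; ring
  · have h1 : HasDerivAt (fun x => Real.exp (-s * x)) (Real.exp (-s * x) * (-s * 1)) x :=
      ((hasDerivAt_id x).const_mul (-s)).exp
    have h2 : HasDerivAt (fun x => Real.cos x + s * Real.sin x)
      (-Real.sin x + s * Real.cos x) x :=
      (Real.hasDerivAt_cos x).add ((Real.hasDerivAt_sin x).const_mul s)
    convert! (h1.mul h2).neg.div_const (1 + s ^ 2) using 1
    field_simp
    ring

lemma abs_cos_add_mul_sin_le (A s : ℝ) : |Real.cos A + s * Real.sin A| ≤ 1 + s ^ 2 := by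
  refine abs_le_of_sq_le_sq ?_ (by positivity)
  nlinarith [sq_nonneg (Real.sin A - s * Real.cos A), Real.sin_sq_add_cos_sq A, sq_nonneg s,
    sq_nonneg (s ^ 2)]

/-- Write $1/x=\int_0^\infty e^{-sx}\,ds$ and exchange the integrals. The inner integral is
$(1+s^2)^{-1}$, whose integral is $\pi/2$, minus a term of modulus at most $e^{-As}$. -/
theorem abs_sineInt_sub_le {A : ℝ} (hA : 0 < A) : |sineInt A - Real.pi / 2| ≤ 1 / A := by
  have hexp : ∀ x : ℝ, 0 < x → IntegrableOn (fun s => Real.exp (-x * s)) (Set.Ioi 0) :=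
    fun x hx => integrableOn_exp_mul_Ioi (neg_lt_zero.2 hx) 0
  have hexpi : ∀ x : ℝ, 0 < x → ∫ s in Set.Ioi (0 : ℝ), Real.exp (-x * s) = x⁻¹ := by
    intro x hx
    rw [integral_exp_mul_Ioi (neg_lt_zero.2 hx) 0]; simp
  have hint : Integrable (Function.uncurry fun x s : ℝ => Real.sin x * Real.exp (-s * x))
      ((volume.restrict (Set.Ioc 0 A)).prod (volume.restrict (Set.Ioi 0))) := by
    have hm : AEStronglyMeasurable (Function.uncurry fun x s : ℝ => Real.sin x * Real.exp (-s * x))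
        ((volume.restrict (Set.Ioc 0 A)).prod (volume.restrict (Set.Ioi 0))) := by
      refine Continuous.aestronglyMeasurable ?_
      unfold Function.uncurry; fun_prop
    rw [integrable_prod_iff hm]
    refine ⟨(ae_restrict_mem measurableSet_Ioc).mono fun x hx => ?_, ?_⟩
    · have := (hexp x hx.1).const_mul (Real.sin x)
      refine this.congr (ae_of_all _ fun s => ?_)
      simp [Function.uncurry, mul_comm]
    · refine Integrable.congr (f := fun x => |Real.sinc x|) ?_ ?_
      · exact (Real.continuous_sinc.abs.integrableOn_Icc).mono_set Set.Ioc_subset_Icc_self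
      · refine (ae_restrict_mem measurableSet_Ioc).mono fun x hx => ?_
        simp only [Function.uncurry, norm_mul, Real.norm_eq_abs, Real.abs_exp]
        rw [integral_const_mul]
        simp_rw [show ∀ s : ℝ, -s * x = -x * s from fun s => by ring]
        rw [hexpi x hx.1, Real.sinc_of_ne_zero hx.1.ne', abs_div, abs_of_pos hx.1, div_eq_mul_inv]
  have hswap := integral_integral_swap hint
  have hleft : ∫ x in Set.Ioc 0 A, ∫ s in Set.Ioi (0 : ℝ), Real.sin x * Real.exp (-s * x) =
      sineInt A := by
    rw [sineInt, intervalIntegral.integral_of_le hA.le]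
    refine setIntegral_congr_fun measurableSet_Ioc fun x hx => ?_
    rw [integral_const_mul]
    simp_rw [show ∀ s : ℝ, -s * x = -x * s from fun s => by ring]
    rw [hexpi x hx.1, Real.sinc_of_ne_zero hx.1.ne', div_eq_mul_inv]
  have hright : ∀ s : ℝ, ∫ x in Set.Ioc 0 A, Real.sin x * Real.exp (-s * x) =
      (1 + s ^ 2)⁻¹ - Real.exp (-A * s) * ((Real.cos A + s * Real.sin A) / (1 + s ^ 2)) := by
    intro s
    rw [← intervalIntegral.integral_of_le hA.le, integral_sin_mul_exp,
      show -s * A = -A * s by ring]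
    ring
  have hb : ∀ s : ℝ, |Real.exp (-A * s) * ((Real.cos A + s * Real.sin A) / (1 + s ^ 2))| ≤
      Real.exp (-A * s) := by
    intro s
    rw [abs_mul, Real.abs_exp, abs_div, abs_of_pos (by positivity : (0 : ℝ) < 1 + s ^ 2)]
    refine mul_le_of_le_one_right (Real.exp_pos _).le ?_
    exact div_le_one_of_le₀ (abs_cos_add_mul_sin_le A s) (by positivity)
  have hI : IntegrableOn (fun s : ℝ => Real.exp (-A * s) *
      ((Real.cos A + s * Real.sin A) / (1 + s ^ 2))) (Set.Ioi 0) := by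
    refine Integrable.mono' (hexp A hA) ?_ (ae_of_all _ hb)
    refine Continuous.aestronglyMeasurable ?_
    have : ∀ s : ℝ, 1 + s ^ 2 ≠ 0 := fun s => by positivity
    fun_prop (disch := assumption)
  rw [hleft] at hswap
  simp_rw [hright] at hswap
  rw [integral_sub integrable_inv_one_add_sq.integrableOn hI, integral_Ioi_inv_one_add_sq,
    Real.arctan_zero, sub_zero] at hswap
  rw [hswap, sub_sub_cancel_left, abs_neg]
  calc _ ≤ ∫ s in Set.Ioi (0 : ℝ), Real.exp (-A * s) := by
        refine abs_integral_le_integral_abs.trans ?_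
        exact integral_mono hI.abs (hexp A hA) hb
    _ = _ := by rw [hexpi A hA, one_div]

/-- Beyond $\pi$ the rate $1/A\le1/3$ around $\pi/2$ is enough; on $[0,\pi]$ the integrand is
nonnegative, so the value lies between 0 and the one at $\pi$. -/
lemma sineInt_mem_Icc {A : ℝ} (hA : 0 ≤ A) : sineInt A ∈ Set.Icc (0 : ℝ) 2 := by
  have hpi := Real.pi_gt_three
  have hpi' := Real.pi_lt_d2
  have large : ∀ A, Real.pi ≤ A → sineInt A ∈ Set.Icc (0 : ℝ) 2 := by
    intro A hA
    have hA3 : 1 / A ≤ 1 / 3 := one_div_le_one_div_of_le (by norm_num) (by linarith)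
    have := abs_le.1 ((abs_sineInt_sub_le (by linarith : 0 < A)).trans hA3)
    constructor <;> linarith [this.1, this.2]
  rcases le_or_gt Real.pi A with h | h
  · exact large A h
  · have nonneg : ∀ x ∈ Set.Icc 0 Real.pi, 0 ≤ Real.sinc x := by
      intro x hx
      rcases hx.1.eq_or_lt with h0 | h0
      · rw [← h0]; simp
      · rw [Real.sinc_of_ne_zero h0.ne']
        exact div_nonneg (Real.sin_nonneg_of_mem_Icc hx) h0.le
    have h1 : 0 ≤ ∫ u in A..Real.pi, Real.sinc u :=
      intervalIntegral.integral_nonneg h.le fun x hx => nonneg x ⟨hA.trans hx.1, hx.2⟩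
    have h2 : sineInt A + ∫ u in A..Real.pi, Real.sinc u = sineInt Real.pi :=
      intervalIntegral.integral_add_adjacent_intervals (intervalIntegrable_sinc _ _)
        (intervalIntegrable_sinc _ _)
    refine ⟨intervalIntegral.integral_nonneg hA fun x hx => nonneg x ⟨hx.1, hx.2.trans h.le⟩, ?_⟩
    linarith [(large Real.pi le_rfl).2]

lemma abs_sineInt_le (A : ℝ) : |sineInt A| ≤ 2 := by
  rcases le_total 0 A with h | h
  · have := sineInt_mem_Icc h
    rw [abs_of_nonneg this.1]; exact this.2
  · have := sineInt_mem_Icc (neg_nonneg.2 h)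
    rw [sineInt_neg] at this
    rw [abs_of_nonpos (by linarith [this.1])]; exact this.2

lemma integral_sin_div (x y a : ℝ) :
    ∫ ω in x..y, ω⁻¹ * Real.sin (ω * a) = sineInt (y * a) - sineInt (x * a) := by
  have h1 : ∫ ω in x..y, ω⁻¹ * Real.sin (ω * a) = ∫ ω in x..y, a * Real.sinc (ω * a) := by
    refine intervalIntegral.integral_congr_ae ?_
    -- The integrands may differ at $\omega=0$, where `ω⁻¹` is 0 but `sinc` is 1.
    filter_upwards [compl_mem_ae_iff.2 (measure_singleton (0 : ℝ))] with ω hω _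
    have hω : ω ≠ 0 := hω
    rcases eq_or_ne a 0 with rfl | ha
    · simp
    · rw [Real.sinc_of_ne_zero (mul_ne_zero hω ha)]; field_simp
  rw [h1, intervalIntegral.integral_const_mul, intervalIntegral.mul_integral_comp_mul_right,
    sineInt, sineInt, intervalIntegral.integral_interval_sub_left] <;>
  exact intervalIntegrable_sinc _ _

lemma abs_integral_sin_div_le {x y : ℝ} (hx : 0 ≤ x) (hy : 0 ≤ y) (a : ℝ) :
    |∫ ω in x..y, ω⁻¹ * Real.sin (ω * a)| ≤ 2 := by
  rw [integral_sin_div, abs_le]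
  rcases le_total 0 a with h | h
  · have h1 := sineInt_mem_Icc (mul_nonneg hx h)
    have h2 := sineInt_mem_Icc (mul_nonneg hy h)
    constructor <;> linarith [h1.1, h1.2, h2.1, h2.2]
  · have h1 := sineInt_mem_Icc (mul_nonneg hx (neg_nonneg.2 h))
    have h2 := sineInt_mem_Icc (mul_nonneg hy (neg_nonneg.2 h))
    rw [mul_neg, sineInt_neg] at h1 h2
    constructor <;> linarith [h1.1, h1.2, h2.1, h2.2]

lemma tendsto_sineInt_atTop :
    Filter.Tendsto sineInt Filter.atTop (nhds (Real.pi / 2)) := by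
  rw [tendsto_iff_dist_tendsto_zero]
  refine squeeze_zero' (Filter.Eventually.of_forall fun _ => dist_nonneg)
    ((Filter.eventually_gt_atTop 0).mono fun A hA => ?_)
    (tendsto_inv_atTop_zero (𝕜 := ℝ))
  rw [Real.dist_eq, ← one_div]
  exact abs_sineInt_sub_le hA

/-! ### Integrability at frequency zero. -/

lemma im_exp_mul_charFun (μ : Measure ℝ) [IsProbabilityMeasure μ] (a ω : ℝ) :
    (Complex.exp (Complex.I * ω * a) * charFun μ ω).im = ∫ z, Real.sin (ω * (a + z)) ∂μ := by
  rw [charFun_apply_real, ← integral_const_mul]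
  have hi : Integrable (fun z : ℝ => Complex.exp (Complex.I * ω * a) *
      Complex.exp (ω * z * Complex.I)) μ := by
    refine Integrable.of_bound (Continuous.aestronglyMeasurable (by fun_prop)) 1
      (ae_of_all _ fun z => ?_)
    rw [← Complex.exp_add, show Complex.I * ω * a + ω * z * Complex.I =
      ((ω * (a + z) : ℝ) : ℂ) * Complex.I by push_cast; ring, Complex.norm_exp_ofReal_mul_I]
  have := integral_im hi
  simp only [RCLike.im_to_complex] at this
  rw [← this]
  congr 1
  ext z
  rw [← Complex.exp_add, show Complex.I * ω * a + ω * z * Complex.I =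
      ((ω * (a + z) : ℝ) : ℂ) * Complex.I by push_cast; ring, Complex.exp_ofReal_mul_I_im]

lemma integral_sin_sq_diff (μ : Measure ℝ) [IsProbabilityMeasure μ] (ω : ℝ) :
    ∫ p, Real.sin (ω * (p.1 - p.2)) ^ 2 ∂(μ.prod μ) = (1 - ‖charFun μ (2 * ω)‖ ^ 2) / 2 := by
  have hi : Integrable (fun p : ℝ × ℝ => Complex.exp ((2 * ω * (p.1 - p.2) : ℝ) * Complex.I))
      (μ.prod μ) := by
    refine Integrable.of_bound (Continuous.aestronglyMeasurable (by fun_prop)) 1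
      (ae_of_all _ fun z => ?_)
    rw [Complex.norm_exp_ofReal_mul_I]
  have hcos : ∫ p, Real.cos (2 * ω * (p.1 - p.2)) ∂(μ.prod μ) = ‖charFun μ (2 * ω)‖ ^ 2 := by
    have h1 : ∫ p : ℝ × ℝ, Complex.exp ((2 * ω * (p.1 - p.2) : ℝ) * Complex.I) ∂(μ.prod μ) =
        charFun μ (2 * ω) * charFun μ (-(2 * ω)) := by
      rw [charFun_apply_real, charFun_apply_real, ← integral_prod_mul]
      congr 1; ext p
      rw [← Complex.exp_add]; congr 1; push_cast; ring
    rw [charFun_neg, Complex.mul_conj, Complex.normSq_eq_norm_sq] at h1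
    have h2 := integral_re hi
    simp only [RCLike.re_to_complex, Complex.exp_ofReal_mul_I_re] at h2
    rw [h2, h1, Complex.ofReal_re]
  have hs : ∀ p : ℝ × ℝ, Real.sin (ω * (p.1 - p.2)) ^ 2 =
      1 / 2 - 1 / 2 * Real.cos (2 * ω * (p.1 - p.2)) := fun p => by
    rw [Real.sin_sq_eq_half_sub]; ring_nf
  simp_rw [hs]
  rw [integral_sub (by fun_prop) ?_, integral_const_mul, hcos]
  · simp; ring
  · refine Integrable.const_mul (Integrable.of_bound
      (Continuous.aestronglyMeasurable (by fun_prop)) 1 (ae_of_all _ fun z => ?_)) _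
    simpa using Real.abs_cos_le_one _

/-- The characteristic function of `μ` is at least `1 - b |ω|^τ` in modulus for `|ω| ≤ w`. -/
def NearOne (μ : Measure ℝ) (w b τ : ℝ) : Prop :=
  ∀ ω : ℝ, |ω| ≤ w → 1 - b * |ω| ^ τ ≤ ‖charFun μ ω‖

/-- The local assumption restricts only the modulus of the characteristic function, hence only the
law of the difference of two independent errors. Its mean squared sine is $(1-|\hat
f(2\omega)|^2)/2=O(\omega^\tau)$, and $|s|\le c/2+s^2/(2c)$ with $c=\omega^{\tau/2}$ passes to the
first moment. -/
lemma exists_integral_abs_sin_diff_le {μ : Measure ℝ} [IsProbabilityMeasure μ] {w b τ : ℝ}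
    (hw : 0 < w) (hb : 0 < b) (hτ : 0 < τ) (h : NearOne μ w b τ) :
    ∃ C : ℝ, ∀ ω : ℝ, 0 < ω →
      ∫ p, |Real.sin (ω * (p.1 - p.2))| ∂(μ.prod μ) ≤ C * ω ^ (τ / 2) := by
  refine ⟨max ((1 + b * 2 ^ τ) / 2) ((2 / w) ^ (τ / 2)), fun ω hω => ?_⟩
  have hpos : 0 < ω ^ (τ / 2) := Real.rpow_pos_of_pos hω _
  have hi : Integrable (fun p : ℝ × ℝ => |Real.sin (ω * (p.1 - p.2))|) (μ.prod μ) :=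
    Integrable.of_bound (Continuous.aestronglyMeasurable (by fun_prop)) 1
      (ae_of_all _ fun z => by simpa using Real.abs_sin_le_one _)
  have hi2 : Integrable (fun p : ℝ × ℝ => Real.sin (ω * (p.1 - p.2)) ^ 2) (μ.prod μ) :=
    Integrable.of_bound (Continuous.aestronglyMeasurable (by fun_prop)) 1
      (ae_of_all _ fun z => by simpa using Real.abs_sin_le_one _)
  rcases le_or_gt (2 * ω) w with hle | hgt
  · refine le_trans ?_ (mul_le_mul_of_nonneg_right (le_max_left _ _) hpos.le)
    set c := ω ^ (τ / 2) with hc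
    have hcc : c * c = ω ^ τ := by rw [hc, ← Real.rpow_add hω]; ring_nf
    have h1 : ∫ p, |Real.sin (ω * (p.1 - p.2))| ∂(μ.prod μ) ≤
        ∫ p, (c / 2 + (2 * c)⁻¹ * Real.sin (ω * (p.1 - p.2)) ^ 2) ∂(μ.prod μ) := by
      refine integral_mono hi (by fun_prop) fun p => ?_
      simp only
      have h0 := sq_nonneg (c - |Real.sin (ω * (p.1 - p.2))|)
      have h3 : c / 2 + (2 * c)⁻¹ * Real.sin (ω * (p.1 - p.2)) ^ 2 =
          (c ^ 2 + |Real.sin (ω * (p.1 - p.2))| ^ 2) / (2 * c) := by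
        rw [sq_abs]; field_simp
      rw [h3, le_div_iff₀ (by positivity)]
      linarith
    rw [integral_add (by fun_prop) (by fun_prop), integral_const_mul, integral_sin_sq_diff] at h1
    have h2 := h (2 * ω) (by rwa [abs_of_pos (by positivity)])
    rw [abs_of_pos (by positivity), Real.mul_rpow (by norm_num) hω.le] at h2
    have h3 : (1 - ‖charFun μ (2 * ω)‖ ^ 2) / 2 ≤ b * 2 ^ τ * (c * c) := by
      have := norm_charFun_le_one (μ := μ) (2 * ω)
      rw [hcc]
      nlinarith [norm_nonneg (charFun μ (2 * ω))]
    refine h1.trans ?_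
    have h4 : (2 * c)⁻¹ * ((1 - ‖charFun μ (2 * ω)‖ ^ 2) / 2) ≤
        (2 * c)⁻¹ * (b * 2 ^ τ * (c * c)) := by gcongr
    have h5 : (2 * c)⁻¹ * (b * 2 ^ τ * (c * c)) = b * 2 ^ τ / 2 * c := by field_simp
    simp
    simp at h4 h5
    linarith
  · refine le_trans ?_ (mul_le_mul_of_nonneg_right (le_max_right _ _) hpos.le)
    have h1 : ∫ p, |Real.sin (ω * (p.1 - p.2))| ∂(μ.prod μ) ≤ ∫ _, (1 : ℝ) ∂(μ.prod μ) :=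
      integral_mono hi (by fun_prop) fun p => Real.abs_sin_le_one _
    refine h1.trans ?_
    rw [← Real.mul_rpow (by positivity) hω.le]
    simp only [integral_const, probReal_univ, smul_eq_mul, mul_one]
    refine Real.one_le_rpow ?_ (by positivity)
    rw [div_mul_eq_mul_div, one_le_div hw]
    exact hgt.le

lemma integrableOn_rpow_Ioc {r : ℝ} (hr : -1 < r) (T : ℝ) :
    IntegrableOn (fun ω : ℝ => ω ^ r) (Set.Ioc 0 T) := by
  rcases le_total 0 T with h | h
  · exact (intervalIntegrable_iff_integrableOn_Ioc_of_le h).1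
      (intervalIntegral.intervalIntegrable_rpow' hr)
  · simp [Set.Ioc_eq_empty_of_le h]

/-- Symmetrisation: integrability holds for the difference of two independent errors because
$\omega^{\tau/2-1}$ is integrable at 0. Freezing one error at a suitable value and shifting it to
$a$ costs only a bounded term. -/
theorem integrable_sin_div {μ : Measure ℝ} [IsProbabilityMeasure μ] {w b τ : ℝ}
    (hw : 0 < w) (hb : 0 < b) (hτ : 0 < τ) (h : NearOne μ w b τ) (T a : ℝ) :
    Integrable (fun p : ℝ × ℝ => p.1⁻¹ * Real.sin (p.1 * (a - p.2)))
      ((volume.restrict (Set.Ioc 0 T)).prod μ) := by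
  obtain ⟨C, hC⟩ := exists_integral_abs_sin_diff_le hw hb hτ h
  have hA : Integrable (fun p : ℝ × (ℝ × ℝ) => p.1⁻¹ * Real.sin (p.1 * (p.2.1 - p.2.2)))
      ((volume.restrict (Set.Ioc 0 T)).prod (μ.prod μ)) := by
    rw [integrable_prod_iff (Measurable.aestronglyMeasurable (by fun_prop))]
    refine ⟨ae_of_all _ fun ω => ?_, ?_⟩
    · refine (Integrable.of_bound (μ := μ.prod μ) (f := fun p : ℝ × ℝ => Real.sin (ω * (p.1 - p.2)))
        (Continuous.aestronglyMeasurable (by fun_prop)) 1 (ae_of_all _ fun z => ?_)).const_mul ω⁻¹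
      simpa using Real.abs_sin_le_one _
    · refine Integrable.mono' (g := fun ω => C * ω ^ (τ / 2 - 1))
        ((integrableOn_rpow_Ioc (by linarith) T).const_mul C) ?_ ?_
      · exact (StronglyMeasurable.integral_prod_right
          (Measurable.stronglyMeasurable (by fun_prop))).aestronglyMeasurable
      · refine (ae_restrict_mem measurableSet_Ioc).mono fun ω hω => ?_
        rw [Real.norm_of_nonneg (integral_nonneg fun _ => norm_nonneg _)]
        simp only [norm_mul, norm_inv, Real.norm_eq_abs, abs_of_pos hω.1]
        rw [integral_const_mul, Real.rpow_sub_one hω.1.ne', mul_div_assoc', div_eq_inv_mul]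
        have := hC ω hω.1
        have := hω.1
        gcongr
  have hB := ((measurePreserving_prodAssoc (volume.restrict (Set.Ioc 0 T)) μ μ).integrable_comp_emb
    MeasurableEquiv.prodAssoc.measurableEmbedding).2 hA
  -- Fubini: almost every value of the second error may be frozen.
  obtain ⟨z', hz'⟩ := hB.prod_left_ae.exists
  refine Integrable.mono' (g := fun p : ℝ × ℝ => |a - z'| + |p.1⁻¹ * Real.sin (p.1 * (p.2 - z'))|)
    ?_ (Measurable.aestronglyMeasurable (by fun_prop)) (ae_of_all _ fun p => ?_)
  · refine Integrable.add (integrable_const _) ?_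
    simpa [Function.comp_def] using! hz'.abs
  · rw [show p.1 * (a - p.2) = p.1 * (a - z') - p.1 * (p.2 - z') by ring, Real.sin_sub, mul_sub]
    have h1 : |p.1⁻¹ * Real.sin (p.1 * (a - z'))| ≤ |a - z'| := by
      rw [abs_mul]
      rcases eq_or_ne p.1 0 with h0 | h0
      · simp [h0]
      · calc |p.1⁻¹| * |Real.sin (p.1 * (a - z'))| ≤ |p.1⁻¹| * |p.1 * (a - z')| := by
              exact mul_le_mul_of_nonneg_left Real.abs_sin_le_abs (abs_nonneg _)
          _ = |a - z'| := by rw [abs_mul, abs_inv]; field_simp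
    refine (norm_sub_le _ _).trans (add_le_add ?_ ?_)
    · rw [← mul_assoc, norm_mul]
      exact (mul_le_of_le_one_right (norm_nonneg _) (Real.abs_cos_le_one _)).trans h1
    · rw [mul_left_comm, norm_mul]
      exact mul_le_of_le_one_left (norm_nonneg _) (Real.abs_cos_le_one _)

/-- The mean of `ω⁻¹ sin (ω (a - z))` when `z` has distribution `μ`. -/
noncomputable def sinMean (μ : Measure ℝ) (a ω : ℝ) : ℝ := ∫ z, ω⁻¹ * Real.sin (ω * (a - z)) ∂μ

lemma abs_sinMean_le (μ : Measure ℝ) [IsProbabilityMeasure μ] (a : ℝ) {ω : ℝ} (hω : 0 < ω) :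
    |sinMean μ a ω| ≤ ω⁻¹ := by
  have := norm_integral_le_of_norm_le_const (μ := μ) (C := ω⁻¹)
    (f := fun z => ω⁻¹ * Real.sin (ω * (a - z))) (ae_of_all _ fun z => by
      rw [norm_mul, norm_inv, Real.norm_of_nonneg hω.le]
      exact mul_le_of_le_one_right (by positivity) (Real.abs_sin_le_one _))
  simpa [sinMean] using this

lemma intervalIntegrable_sinMean {μ : Measure ℝ} [IsProbabilityMeasure μ] {w b τ : ℝ}
    (hw : 0 < w) (hb : 0 < b) (hτ : 0 < τ) (h : NearOne μ w b τ) (a : ℝ) {x y : ℝ} (hx : 0 ≤ x)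
    (hy : 0 ≤ y) : IntervalIntegrable (sinMean μ a) volume x y := by
  have hm : ∀ y : ℝ, 0 ≤ y → IntervalIntegrable (sinMean μ a) volume 0 y := fun y hy =>
    (intervalIntegrable_iff_integrableOn_Ioc_of_le hy).2
      (integrable_sin_div hw hb hτ h y a).integral_prod_left
  exact (hm x hx).symm.trans (hm y hy)

lemma abs_integral_sinMean_le {μ : Measure ℝ} [IsProbabilityMeasure μ] {w b τ : ℝ}
    (hw : 0 < w) (hb : 0 < b) (hτ : 0 < τ) (h : NearOne μ w b τ) (a : ℝ) {x y : ℝ} (hx : 0 ≤ x)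
    (hxy : x ≤ y) : |∫ ω in x..y, sinMean μ a ω| ≤ 2 := by
  have hi : Integrable (Function.uncurry fun ω z : ℝ => ω⁻¹ * Real.sin (ω * (a - z)))
      ((volume.restrict (Set.Ioc x y)).prod μ) := by
    have h1 := integrable_sin_div hw hb hτ h y a
    refine h1.mono_measure ?_
    exact Measure.prod_mono (Measure.restrict_mono (Set.Ioc_subset_Ioc_left hx) le_rfl) le_rfl
  rw [intervalIntegral.integral_of_le hxy]
  unfold sinMean
  rw [integral_integral_swap hi]
  have := norm_integral_le_of_norm_le_const (μ := μ) (C := 2)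
    (f := fun z => ∫ ω in Set.Ioc x y, ω⁻¹ * Real.sin (ω * (a - z))) (ae_of_all _ fun z => by
      rw [← intervalIntegral.integral_of_le hxy]
      exact abs_integral_sin_div_le hx (hx.trans hxy) _)
  simpa using this

/-! ### Bounds on the integrated kernel near zero and in the tail. -/

/-- Use $1/z=\bar z/|z|^2$ and $\overline{\hat f_\zeta(\omega)}=\hat f_\zeta(-\omega)$. The phase of
$\hat f_\zeta$ goes into an average of sines, and only its modulus remains as a factor. -/
lemma kern_eq (E : ErrorModel) [IsProbabilityMeasure E.law] (t₀ y ω : ℝ) :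
    kern E t₀ y ω = sinMean E.law (y - t₀) ω * (‖charFun E.law ω‖ ^ 2)⁻¹ := by
  have h := im_exp_mul_charFun E.law (-(y - t₀)) (-ω)
  have h1 : ∀ z, -ω * (-(y - t₀) + z) = ω * (y - t₀ - z) := fun z => by ring
  simp_rw [h1] at h
  have h3 : (Complex.exp (Complex.I * ω * (y - t₀)) / charFun E.law ω).im =
      (∫ z, Real.sin (ω * (y - t₀ - z)) ∂E.law) * (‖charFun E.law ω‖ ^ 2)⁻¹ := by
    rw [← h, div_eq_mul_inv, Complex.inv_def, ← charFun_neg, ← mul_assoc, Complex.im_mul_ofReal,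
      Complex.normSq_eq_norm_sq]
    push_cast
    ring_nf
  rw [kern, sinMean, integral_const_mul, h3, mul_assoc]

lemma norm_charFun_pos [IsProbabilityMeasure E.law] (h1 : E.OrdinarySmooth) (ω : ℝ) : 0 < ‖charFun E.law ω‖ := by
  obtain ⟨_, hc, _, h⟩ := h1
  exact lt_of_lt_of_le (by positivity) (h ω).1

lemma continuous_inv_norm_sq [IsProbabilityMeasure E.law] (h1 : E.OrdinarySmooth) :
    Continuous fun ω => (‖charFun E.law ω‖ ^ 2)⁻¹ :=
  ((continuous_charFun).norm.pow 2).inv₀ fun ω => (pow_pos (norm_charFun_pos h1 ω) 2).ne'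

lemma intervalIntegrable_kern [IsProbabilityMeasure E.law] (h1 : E.OrdinarySmooth) (h2 : E.LocalBound) (t₀ y : ℝ) {a b : ℝ}
    (ha : 0 ≤ a) (hb : 0 ≤ b) : IntervalIntegrable (kern E t₀ y) volume a b := by
  obtain ⟨hw, hbz, hτ, h⟩ := h2
  rw [funext (kern_eq E t₀ y)]
  exact (intervalIntegrable_sinMean hw hbz hτ h _ ha hb).mul_continuousOn
    (continuous_inv_norm_sq h1).continuousOn

lemma omegaOne_pos (h2 : E.LocalBound) : 0 < omegaOne E := by
  obtain ⟨hw, hb, _, _⟩ := h2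
  exact lt_min hw (by positivity)

lemma four_mul_omegaOne_rpow_le (h2 : E.LocalBound) : 4 * E.bζ * omegaOne E ^ E.τ ≤ 1 := by
  have h0 := omegaOne_pos h2
  obtain ⟨hw, hb, hτ, _⟩ := h2
  calc 4 * E.bζ * omegaOne E ^ E.τ ≤ 4 * E.bζ * ((4 * E.bζ) ^ (-(1 / E.τ))) ^ E.τ := by
        gcongr; exact min_le_right _ _
    _ = 1 := by
        rw [← Real.rpow_mul (by positivity), neg_mul, one_div_mul_cancel hτ.ne', Real.rpow_neg_one]
        field_simp

lemma abs_inv_norm_sq_sub_one_le [IsProbabilityMeasure E.law] (h1 : E.OrdinarySmooth) (h2 : E.LocalBound) {ω : ℝ} (hω : 0 < ω)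
    (hω1 : ω ≤ omegaOne E) :
    |(‖charFun E.law ω‖ ^ 2)⁻¹ - 1| ≤ 4 * E.bζ * ω ^ E.τ := by
  have hp := norm_charFun_pos h1 ω
  have hle := norm_charFun_le_one (μ := E.law) ω
  have h3 := four_mul_omegaOne_rpow_le h2
  obtain ⟨hw, hb, hτ, h⟩ := h2
  have h4 := h ω (by rw [abs_of_pos hω]; exact hω1.trans (min_le_left _ _))
  rw [abs_of_pos hω] at h4
  have h5 : 4 * E.bζ * ω ^ E.τ ≤ 1 := le_trans (by gcongr) h3
  have hx : 0 ≤ E.bζ * ω ^ E.τ := by positivity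
  generalize ‖charFun E.law ω‖ = p at *
  rw [mul_assoc] at h5 ⊢
  generalize E.bζ * ω ^ E.τ = x at *
  have hp2 : p ^ 2 ≤ 1 := by nlinarith
  have hge : (1 : ℝ) ≤ (p ^ 2)⁻¹ := (one_le_inv₀ (by positivity)).2 hp2
  rw [abs_of_nonneg (by linarith), sub_le_iff_le_add, inv_le_comm₀ (by positivity) (by linarith)]
  have h6 : (1 - x) ^ 2 ≤ p ^ 2 := by
    refine pow_le_pow_left₀ (by linarith) h4 2
  refine le_trans ?_ h6
  rw [inv_le_iff_one_le_mul₀ (by linarith)]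
  nlinarith [mul_nonneg hx hx, mul_nonneg hx (by linarith : 0 ≤ 1 - 4 * x)]

/-- Split $|\hat f_\zeta|^{-2}=1+(|\hat f_\zeta|^{-2}-1)$. The first part is an average of
differences of sine integrals, hence at most 2. The second is at most
$\int4b_\zeta\omega^{\tau-1}\,d\omega\le1/\tau$ by the choice of $\omega_1$. -/
lemma abs_integral_kern_le_of_le [IsProbabilityMeasure E.law] (h1 : E.OrdinarySmooth) (h2 : E.LocalBound) (t₀ y : ℝ) {a b : ℝ}
    (ha : 0 ≤ a) (hab : a ≤ b) (hb : b ≤ omegaOne E) :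
    |∫ ω in a..b, kern E t₀ y ω| ≤ 2 + 1 / E.τ := by
  have hf := four_mul_omegaOne_rpow_le h2
  have h2' := h2
  obtain ⟨hw, hbz, hτ, h⟩ := h2'
  set q := fun ω => (‖charFun E.law ω‖ ^ 2)⁻¹
  set g := fun ω => sinMean E.law (y - t₀) ω
  have hgi : IntervalIntegrable g volume a b :=
    intervalIntegrable_sinMean hw hbz hτ h _ ha (ha.trans hab)
  have hri : IntervalIntegrable (fun ω => g ω * (q ω - 1)) volume a b :=
    hgi.mul_continuousOn ((continuous_inv_norm_sq h1).sub continuous_const).continuousOn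
  have hsplit : ∫ ω in a..b, kern E t₀ y ω =
      (∫ ω in a..b, g ω) + ∫ ω in a..b, g ω * (q ω - 1) := by
    rw [← intervalIntegral.integral_add hgi hri]
    refine intervalIntegral.integral_congr fun ω _ => ?_
    simp only [kern_eq, g, q]
    ring
  have hr : |∫ ω in a..b, g ω * (q ω - 1)| ≤ 1 / E.τ := by
    have hp : IntervalIntegrable (fun ω : ℝ => 4 * E.bζ * ω ^ (E.τ - 1)) volume a b :=
      (intervalIntegral.intervalIntegrable_rpow' (by linarith)).const_mul _
    have := intervalIntegral.norm_integral_le_of_norm_le (μ := volume) hab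
      (f := fun ω => g ω * (q ω - 1)) (g := fun ω : ℝ => 4 * E.bζ * ω ^ (E.τ - 1))
      (ae_of_all _ fun ω hω => ?_) hp
    · refine this.trans ?_
      rw [intervalIntegral.integral_const_mul, integral_rpow (Or.inl (by linarith)),
        sub_add_cancel]
      have hba : b ^ E.τ ≤ omegaOne E ^ E.τ := Real.rpow_le_rpow (ha.trans hab) hb hτ.le
      have ha' : 0 ≤ a ^ E.τ := Real.rpow_nonneg ha _
      rw [mul_div_assoc', div_le_div_iff_of_pos_right hτ]
      nlinarith
    · have hω0 : 0 < ω := lt_of_le_of_lt ha hω.1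
      rw [norm_mul, Real.rpow_sub_one hω0.ne', mul_div_assoc', div_eq_inv_mul]
      exact mul_le_mul (abs_sinMean_le _ _ hω0)
        (abs_inv_norm_sq_sub_one_le h1 h2 hω0 (hω.2.trans hb)) (norm_nonneg _) (by positivity)
  rw [hsplit]
  exact (abs_add_le _ _).trans (add_le_add (abs_integral_sinMean_le hw hbz hτ h _ ha hab) hr)

lemma abs_integral_kern_near_le [IsProbabilityMeasure E.law] (h1 : E.OrdinarySmooth) (h2 : E.LocalBound) (t₀ y : ℝ) {a b : ℝ}
    (ha : 0 ≤ a) (ha' : a ≤ omegaOne E) (hb : 0 ≤ b) (hb' : b ≤ omegaOne E) :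
    |∫ ω in a..b, kern E t₀ y ω| ≤ 2 + 1 / E.τ := by
  rcases le_total a b with h | h
  · exact abs_integral_kern_le_of_le h1 h2 t₀ y ha h hb'
  · rw [intervalIntegral.integral_symm, abs_neg]
    exact abs_integral_kern_le_of_le h1 h2 t₀ y hb h ha'

lemma one_add_sq_rpow_le {β ω : ℝ} (hβ : 0 < β) (hω : 0 < ω) :
    (1 + ω ^ 2) ^ (β / 2) ≤ 2 ^ max (β / 2 - 1) 0 * (1 + ω ^ β) := by
  have e : (ω ^ 2) ^ (β / 2) = ω ^ β := by
    rw [← Real.rpow_natCast, ← Real.rpow_mul hω.le]; congr 1; push_cast; ring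
  rcases le_total (β / 2) 1 with h | h
  · rw [max_eq_right (by linarith), Real.rpow_zero, one_mul]
    have := Real.rpow_add_le_add_rpow (p := β / 2) zero_le_one (sq_nonneg ω) (by positivity) h
    rwa [Real.one_rpow, e] at this
  · rw [max_eq_left (by linarith)]
    have := NNReal.rpow_add_le_mul_rpow_add_rpow 1 (Real.toNNReal (ω ^ 2)) h
    rw [← NNReal.coe_le_coe] at this
    push_cast at this
    rwa [Real.coe_toNNReal _ (sq_nonneg ω), Real.one_rpow, e] at this

lemma abs_kern_le [IsProbabilityMeasure E.law] (h1 : E.OrdinarySmooth) (t₀ y : ℝ) {ω : ℝ} (hω : 0 < ω) :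
    |kern E t₀ y ω| ≤ E.cζ⁻¹ * 2 ^ max (E.β / 2 - 1) 0 * (ω⁻¹ + ω ^ (E.β - 1)) := by
  have hp := norm_charFun_pos h1 ω
  obtain ⟨hβ, hc, _, h⟩ := h1
  have h3 : ‖charFun E.law ω‖⁻¹ ≤ E.cζ⁻¹ * (1 + ω ^ 2) ^ (E.β / 2) := by
    have := inv_anti₀ (by positivity) (h ω).1
    rwa [mul_inv, neg_div, Real.rpow_neg (by positivity), inv_inv] at this
  have h4 : |kern E t₀ y ω| ≤ ω⁻¹ * ‖charFun E.law ω‖⁻¹ := by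
    rw [kern, abs_mul, abs_inv, abs_of_pos hω]
    gcongr
    refine (Complex.abs_im_le_norm _).trans_eq ?_
    rw [norm_div, show Complex.I * ω * (y - t₀) = ((ω * (y - t₀) : ℝ) : ℂ) * Complex.I by
      push_cast; ring, Complex.norm_exp_ofReal_mul_I, one_div]
  calc |kern E t₀ y ω| ≤ ω⁻¹ * (E.cζ⁻¹ * (2 ^ max (E.β / 2 - 1) 0 * (1 + ω ^ E.β))) := by
        refine h4.trans ?_
        gcongr
        refine h3.trans ?_
        gcongr
        exact one_add_sq_rpow_le hβ hω
    _ = _ := by rw [Real.rpow_sub_one hω.ne']; field_simp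

lemma abs_integral_kern_tail_le [IsProbabilityMeasure E.law] (h1 : E.OrdinarySmooth) (h2 : E.LocalBound) (t₀ y : ℝ) {l : ℝ}
    (hl : 1 ≤ l) (hl' : omegaOne E ≤ l) :
    |∫ ω in omegaOne E..l, kern E t₀ y ω| ≤ E.cζ⁻¹ * 2 ^ max (E.β / 2 - 1) 0 *
      (E.β⁻¹ * (2 + E.β * max (Real.log (1 / omegaOne E)) 0) * l ^ E.β) := by
  have hw := omegaOne_pos h2
  have hβ := h1.1
  have hc := h1.2.1
  have hl0 : 0 < l := by linarith
  set K := E.cζ⁻¹ * 2 ^ max (E.β / 2 - 1) 0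
  have hK : 0 ≤ K := by positivity
  have hi1 : IntervalIntegrable (fun ω : ℝ => ω⁻¹) volume (omegaOne E) l :=
    intervalIntegral.intervalIntegrable_inv (fun x hx => by
      rw [Set.uIcc_of_le hl'] at hx; exact (hw.trans_le hx.1).ne') continuousOn_id
  have hi2 : IntervalIntegrable (fun ω : ℝ => ω ^ (E.β - 1)) volume (omegaOne E) l :=
    intervalIntegral.intervalIntegrable_rpow' (by linarith)
  have := intervalIntegral.norm_integral_le_of_norm_le (μ := volume) hl'
    (f := kern E t₀ y) (ae_of_all _ fun ω hω => abs_kern_le h1 t₀ y (hw.trans hω.1))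
    ((hi1.add hi2).const_mul K)
  refine this.trans ?_
  rw [intervalIntegral.integral_const_mul, intervalIntegral.integral_add hi1 hi2,
    integral_inv_of_pos hw hl0, integral_rpow (Or.inl (by linarith)), sub_add_cancel]
  gcongr
  have e1 : Real.log (l / omegaOne E) = Real.log l + Real.log (1 / omegaOne E) := by
    rw [div_eq_mul_one_div, Real.log_mul hl0.ne' (by positivity)]
  -- The logarithm from $\int\omega^{-1}\,d\omega$ costs a second $l^\beta/\beta$, whence the 2 in
  -- $\bar m$.
  have e2 := Real.log_le_rpow_div hl0.le hβ
  have e3 : 1 ≤ l ^ E.β := Real.one_le_rpow hl hβ.le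
  have e4 : 0 ≤ omegaOne E ^ E.β := by positivity
  have e5 := le_max_left (Real.log (1 / omegaOne E)) 0
  have e6 := le_max_right (Real.log (1 / omegaOne E)) 0
  generalize max (Real.log (1 / omegaOne E)) 0 = m at *
  have e7 : (l ^ E.β - omegaOne E ^ E.β) / E.β ≤ l ^ E.β / E.β := by gcongr; linarith
  have e8 : E.β⁻¹ * (2 + E.β * m) * l ^ E.β = 2 * (l ^ E.β / E.β) + m * l ^ E.β := by
    field_simp
  rw [e1, e8]
  nlinarith

/-! ### Bounds on the contribution of one observation. -/

lemma sqrt_two_mul_cStar (h2 : E.LocalBound) : √(2 * cStar E) = 2 * ((2 + 1 / E.τ) / Real.pi) := by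
  have := h2.2.2.1
  rw [cStar, show 2 * (2 / Real.pi ^ 2 * (2 + 1 / E.τ) ^ 2) =
    (2 * ((2 + 1 / E.τ) / Real.pi)) ^ 2 by field_simp]
  exact Real.sqrt_sq (by positivity)

/-- The part of `m̄` that accounts for frequencies above `ω₁`. -/
noncomputable def mTail (E : ErrorModel) : ℝ :=
  (Real.pi * E.cζ * E.β)⁻¹ * 2 ^ (1 + max (E.β / 2 - 1) 0) *
    (2 + E.β * max (Real.log (1 / omegaOne E)) 0)

lemma mBar_eq (h2 : E.LocalBound) : mBar E = 2 * ((2 + 1 / E.τ) / Real.pi) + mTail E := by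
  rw [mBar, sqrt_two_mul_cStar h2, mTail]

lemma mTail_pos (h1 : E.OrdinarySmooth) : 0 < mTail E := by
  have := h1.1
  have := h1.2.1
  have := le_max_right (Real.log (1 / omegaOne E)) 0
  have := Real.pi_pos
  unfold mTail
  positivity

lemma mBar_pos (h1 : E.OrdinarySmooth) (h2 : E.LocalBound) : 0 < mBar E := by
  have := h2.2.2.1
  have := mTail_pos h1
  rw [mBar_eq h2]
  positivity

/-- The contribution of one observation to the estimator. -/
noncomputable def score (E : ErrorModel) (t₀ l y : ℝ) : ℝ :=
  1 / Real.pi * ∫ ω in (0 : ℝ)..l, kern E t₀ y ω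

/-- The contribution to `score` of the frequencies above `ω₁`. -/
noncomputable def tailScore (E : ErrorModel) (t₀ l y : ℝ) : ℝ :=
  1 / Real.pi * ∫ ω in omegaOne E..l, kern E t₀ y ω

lemma abs_near_le [IsProbabilityMeasure E.law] (h1 : E.OrdinarySmooth) (h2 : E.LocalBound) (t₀ y : ℝ) {a b : ℝ}
    (ha : 0 ≤ a) (ha' : a ≤ omegaOne E) (hb : 0 ≤ b) (hb' : b ≤ omegaOne E) :
    |1 / Real.pi * ∫ ω in a..b, kern E t₀ y ω| ≤ (2 + 1 / E.τ) / Real.pi := by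
  have := Real.pi_pos
  rw [abs_mul, abs_of_pos (by positivity), one_div_mul_eq_div]
  gcongr
  exact abs_integral_kern_near_le h1 h2 t₀ y ha ha' hb hb'

lemma abs_tailScore_le_of_le [IsProbabilityMeasure E.law] (h1 : E.OrdinarySmooth) (h2 : E.LocalBound) (t₀ y : ℝ) {l : ℝ}
    (hl : 1 ≤ l) (hl' : omegaOne E ≤ l) : |tailScore E t₀ l y| ≤ mTail E / 2 * l ^ E.β := by
  have := Real.pi_pos
  have hβ := h1.1
  have hc := h1.2.1
  rw [tailScore, abs_mul, abs_of_pos (by positivity)]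
  calc _ ≤ 1 / Real.pi * (E.cζ⁻¹ * 2 ^ max (E.β / 2 - 1) 0 *
      (E.β⁻¹ * (2 + E.β * max (Real.log (1 / omegaOne E)) 0) * l ^ E.β)) := by
        gcongr; exact abs_integral_kern_tail_le h1 h2 t₀ y hl hl'
    _ = _ := by
        rw [mTail, Real.rpow_add (by norm_num), Real.rpow_one]; field_simp

lemma score_eq_add [IsProbabilityMeasure E.law] (h1 : E.OrdinarySmooth) (h2 : E.LocalBound) (t₀ y : ℝ) {l : ℝ} (hl : 1 ≤ l) :
    score E t₀ l y = 1 / Real.pi * (∫ ω in (0 : ℝ)..omegaOne E, kern E t₀ y ω) +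
      tailScore E t₀ l y := by
  have hw := omegaOne_pos h2
  rw [score, tailScore, ← mul_add, intervalIntegral.integral_add_adjacent_intervals] <;>
  exact intervalIntegrable_kern h1 h2 t₀ y (by linarith) (by linarith)

lemma abs_score_le [IsProbabilityMeasure E.law] (h1 : E.OrdinarySmooth) (h2 : E.LocalBound) (t₀ y : ℝ) {l : ℝ} (hl : 1 ≤ l) :
    |score E t₀ l y| ≤ mBar E * l ^ E.β / 2 := by
  have hw := omegaOne_pos h2
  have hτ := h2.2.2.1
  have hT := mTail_pos h1
  have hpi := Real.pi_pos
  have h3 : 1 ≤ l ^ E.β := Real.one_le_rpow hl h1.1.le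
  have h4 : 0 < (2 + 1 / E.τ) / Real.pi := by positivity
  rw [mBar_eq h2]
  rcases le_total l (omegaOne E) with h | h
  · have := abs_near_le h1 h2 t₀ y le_rfl hw.le (by linarith) h
    rw [score]; nlinarith
  · rw [score_eq_add h1 h2 t₀ y hl]
    have h5 := abs_near_le h1 h2 t₀ y le_rfl hw.le hw.le le_rfl
    have h6 := abs_tailScore_le_of_le h1 h2 t₀ y hl h
    refine (abs_add_le _ _).trans ((add_le_add h5 h6).trans ?_)
    nlinarith

/-- When $l<\omega_1$ the integral runs backwards inside the low-frequency range, so the near-zero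
bound applies. -/
lemma abs_tailScore_le [IsProbabilityMeasure E.law] (h1 : E.OrdinarySmooth) (h2 : E.LocalBound) (t₀ y : ℝ) {l : ℝ}
    (hl : 1 ≤ l) : |tailScore E t₀ l y| ≤ mBar E * l ^ E.β / 2 := by
  have hw := omegaOne_pos h2
  have hτ := h2.2.2.1
  have hT := mTail_pos h1
  have hpi := Real.pi_pos
  have h3 : 1 ≤ l ^ E.β := Real.one_le_rpow hl h1.1.le
  have h4 : 0 < (2 + 1 / E.τ) / Real.pi := by positivity
  rw [mBar_eq h2]
  rcases le_total l (omegaOne E) with h | h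
  · have := abs_near_le h1 h2 t₀ y hw.le le_rfl (by linarith) h
    rw [tailScore]; nlinarith
  · have h6 := abs_tailScore_le_of_le h1 h2 t₀ y hl h
    nlinarith

/-- $(a+b)^2\le2a^2+2b^2$ with the low-frequency part bounded uniformly. This is why $\sigma_l^2$
has its form: it dominates the second moment of `score`. -/
lemma score_sq_le [IsProbabilityMeasure E.law] (h1 : E.OrdinarySmooth) (h2 : E.LocalBound) (t₀ y : ℝ) {l : ℝ} (hl : 1 ≤ l) :
    score E t₀ l y ^ 2 ≤ cStar E + 2 * tailScore E t₀ l y ^ 2 := by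
  have hw := omegaOne_pos h2
  have h5 := abs_near_le h1 h2 t₀ y le_rfl hw.le hw.le le_rfl
  have h6 := pow_le_pow_left₀ (abs_nonneg _) h5 2
  rw [sq_abs] at h6
  rw [score_eq_add h1 h2 t₀ y hl]
  have : cStar E = 2 * ((2 + 1 / E.τ) / Real.pi) ^ 2 := by rw [cStar]; ring
  rw [this]
  nlinarith [sq_nonneg (1 / Real.pi * (∫ ω in (0 : ℝ)..omegaOne E, kern E t₀ y ω) -
    tailScore E t₀ l y)]

/-! ### Measurability, mean and bias of the estimator. -/

lemma measurable_kern (E : ErrorModel) [IsProbabilityMeasure E.law] (t₀ : ℝ) :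
    Measurable (Function.uncurry (kern E t₀)) := by
  unfold kern Function.uncurry
  have := measurable_charFun (μ := E.law)
  fun_prop

lemma measurable_integral_kern [IsProbabilityMeasure E.law] (t₀ a b : ℝ) :
    Measurable fun y => ∫ ω in a..b, kern E t₀ y ω := by
  unfold intervalIntegral
  refine Measurable.sub ?_ ?_ <;>
  exact (StronglyMeasurable.integral_prod_right
    (measurable_kern E t₀).stronglyMeasurable).measurable

lemma measurable_score [IsProbabilityMeasure E.law] (t₀ l : ℝ) : Measurable (score E t₀ l) :=
  (measurable_integral_kern t₀ 0 l).const_mul _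

lemma measurable_tailScore [IsProbabilityMeasure E.law] (t₀ l : ℝ) : Measurable (tailScore E t₀ l) :=
  (measurable_integral_kern t₀ _ l).const_mul _

instance isProbabilityMeasure_obsLaw [IsProbabilityMeasure E.law] (F : Measure ℝ)
    [IsProbabilityMeasure F] : IsProbabilityMeasure (obsLaw E F) := by
  unfold obsLaw; infer_instance

/-- The characteristic function of a convolution is a product, so dividing by $\hat f_\zeta$ leaves
that of $F$. -/
lemma integral_kern_obsLaw [IsProbabilityMeasure E.law] (h1 : E.OrdinarySmooth) (F : Measure ℝ)
    [IsProbabilityMeasure F] (t₀ ω : ℝ) :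
    ∫ y, kern E t₀ y ω ∂(obsLaw E F) = ∫ x, ω⁻¹ * Real.sin (ω * (x - t₀)) ∂F := by
  have hp : charFun E.law ω ≠ 0 := norm_pos_iff.1 (norm_charFun_pos h1 ω)
  have hexp : ∀ y : ℝ, Complex.exp (Complex.I * ω * (y - t₀)) / charFun E.law ω =
      (Complex.exp (Complex.I * ω * (-t₀ : ℝ)) / charFun E.law ω) *
        Complex.exp (ω * y * Complex.I) := by
    intro y
    rw [div_mul_eq_mul_div, ← Complex.exp_add]
    congr 2; push_cast; ring
  have hi : Integrable (fun y : ℝ => Complex.exp (Complex.I * ω * (y - t₀)) / charFun E.law ω)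
      (obsLaw E F) := by
    simp_rw [hexp]
    refine (Integrable.of_bound (μ := obsLaw E F)
      (f := fun y : ℝ => Complex.exp (ω * y * Complex.I))
      (Continuous.aestronglyMeasurable (by fun_prop)) 1 (ae_of_all _ fun z => ?_)).const_mul _
    rw [← Complex.ofReal_mul, Complex.norm_exp_ofReal_mul_I]
  have him := integral_im hi
  simp only [RCLike.im_to_complex] at him
  unfold kern
  rw [integral_const_mul, integral_const_mul, him]
  congr 1
  simp_rw [hexp]
  rw [integral_const_mul, ← charFun_apply_real, obsLaw, charFun_conv,
    show ∀ a b c : ℂ, c ≠ 0 → a / c * (b * c) = a * b from fun a b c hc => by field_simp]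
  · rw [im_exp_mul_charFun]
    simp_rw [neg_add_eq_sub]
  · exact hp

lemma abs_inv_mul_sin_le {ω : ℝ} (hω : 0 < ω) (s : ℝ) : |ω⁻¹ * Real.sin s| ≤ ω⁻¹ := by
  rw [abs_mul, abs_of_pos (inv_pos.2 hω)]
  exact mul_le_of_le_one_right (inv_pos.2 hω).le (Real.abs_sin_le_one _)

lemma intervalIntegrable_inv_of_pos {a b : ℝ} (ha : 0 < a) (hab : a ≤ b) :
    IntervalIntegrable (fun ω : ℝ => ω⁻¹) volume a b :=
  intervalIntegral.intervalIntegrable_inv (fun x hx => by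
    rw [Set.uIcc_of_le hab] at hx; exact (ha.trans_le hx.1).ne') continuousOn_id

lemma integral_integral_sin (F : Measure ℝ) [IsProbabilityMeasure F] (t₀ : ℝ) {a b : ℝ}
    (ha : 0 < a) (hab : a ≤ b) :
    ∫ ω in a..b, (∫ x, ω⁻¹ * Real.sin (ω * (x - t₀)) ∂F) =
      ∫ x, (sineInt (b * (x - t₀)) - sineInt (a * (x - t₀))) ∂F := by
  simp_rw [← integral_sin_div, intervalIntegral.integral_of_le hab]
  refine integral_integral_swap ?_
  refine Integrable.mono' (g := fun p : ℝ × ℝ => p.1⁻¹) ?_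
    (Measurable.aestronglyMeasurable (by unfold Function.uncurry; fun_prop)) ?_
  · exact Integrable.comp_fst ((intervalIntegrable_iff_integrableOn_Ioc_of_le hab).1
      (intervalIntegrable_inv_of_pos ha hab)) F
  · filter_upwards [Measure.quasiMeasurePreserving_fst.ae (ae_restrict_mem measurableSet_Ioc)]
      with p hp
    exact abs_inv_mul_sin_le (ha.trans hp.1) _

lemma integral_integral_kern [IsProbabilityMeasure E.law] (h1 : E.OrdinarySmooth) (F : Measure ℝ)
    [IsProbabilityMeasure F] (t₀ : ℝ) {a b : ℝ} (ha : 0 < a) (hab : a ≤ b) :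
    ∫ y, (∫ ω in a..b, kern E t₀ y ω) ∂(obsLaw E F) =
      ∫ x, (sineInt (b * (x - t₀)) - sineInt (a * (x - t₀))) ∂F := by
  rw [← integral_integral_sin F t₀ ha hab]
  simp_rw [← integral_kern_obsLaw h1, intervalIntegral.integral_of_le hab]
  refine (integral_integral_swap ?_).symm
  set K := E.cζ⁻¹ * 2 ^ max (E.β / 2 - 1) 0
  refine Integrable.mono' (g := fun p : ℝ × ℝ => K * (p.1⁻¹ + p.1 ^ (E.β - 1))) ?_
    ((measurable_kern E t₀).comp measurable_swap).aestronglyMeasurable ?_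
  · have h3 : IntegrableOn (fun ω : ℝ => K * (ω⁻¹ + ω ^ (E.β - 1))) (Set.Ioc a b) :=
      (intervalIntegrable_iff_integrableOn_Ioc_of_le hab).1
        (((intervalIntegrable_inv_of_pos ha hab).add (intervalIntegral.intervalIntegrable_rpow'
          (by linarith [h1.1]))).const_mul K)
    exact Integrable.comp_fst h3 (obsLaw E F)
  · filter_upwards [Measure.quasiMeasurePreserving_fst.ae (ae_restrict_mem measurableSet_Ioc)]
      with p hp
    exact abs_kern_le h1 t₀ p.2 (ha.trans hp.1)

lemma integrable_sineInt (F : Measure ℝ) [IsProbabilityMeasure F] (a t₀ : ℝ) :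
    Integrable (fun x => sineInt (a * (x - t₀))) F :=
  Integrable.of_bound (continuous_sineInt.comp (by fun_prop)).aestronglyMeasurable 2
    (ae_of_all _ fun _ => abs_sineInt_le _)

lemma tendsto_integral_sineInt_zero (F : Measure ℝ) [IsProbabilityMeasure F] (t₀ : ℝ) :
    Filter.Tendsto (fun δ => ∫ x, sineInt (δ * (x - t₀)) ∂F) (𝓝[>] 0) (𝓝 0) := by
  have h : Filter.Tendsto (fun δ => ∫ x, sineInt (δ * (x - t₀)) ∂F) (𝓝[>] 0)
      (𝓝 (∫ _, (0 : ℝ) ∂F)) := by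
    refine tendsto_integral_filter_of_dominated_convergence (fun _ => 2)
      (Filter.Eventually.of_forall fun δ => (integrable_sineInt F δ t₀).aestronglyMeasurable)
      (Filter.Eventually.of_forall fun δ => ae_of_all _ fun x => abs_sineInt_le _)
      (integrable_const _) (ae_of_all _ fun x => ?_)
    have : Filter.Tendsto (fun δ : ℝ => sineInt (δ * (x - t₀))) (𝓝 0)
        (𝓝 (sineInt (0 * (x - t₀)))) :=
      (continuous_sineInt.comp (by fun_prop)).tendsto 0
    rw [zero_mul, sineInt_zero] at this
    exact this.mono_left nhdsWithin_le_nhds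
  simpa using h

lemma tendsto_integral_kern_zero [IsProbabilityMeasure E.law] (h1 : E.OrdinarySmooth)
    (h2 : E.LocalBound) (F : Measure ℝ) [IsProbabilityMeasure F] (t₀ : ℝ) :
    Filter.Tendsto (fun δ => ∫ y, (∫ ω in (0 : ℝ)..δ, kern E t₀ y ω) ∂(obsLaw E F)) (𝓝[>] 0)
      (𝓝 0) := by
  have hw := omegaOne_pos h2
  have h : Filter.Tendsto (fun δ => ∫ y, (∫ ω in (0 : ℝ)..δ, kern E t₀ y ω) ∂(obsLaw E F)) (𝓝[>] 0)
      (𝓝 (∫ _, (0 : ℝ) ∂(obsLaw E F))) := by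
    refine tendsto_integral_filter_of_dominated_convergence (fun _ => 2 + 1 / E.τ)
      (Filter.Eventually.of_forall fun δ =>
        (measurable_integral_kern t₀ 0 δ).aestronglyMeasurable)
      (Filter.eventually_of_mem (Ioc_mem_nhdsGT hw) fun δ hδ => ae_of_all _ fun y => ?_)
      (integrable_const _) (ae_of_all _ fun y => ?_)
    · exact abs_integral_kern_near_le h1 h2 t₀ y le_rfl hw.le hδ.1.le hδ.2
    · have hc := intervalIntegral.continuousOn_primitive_interval'
        (intervalIntegrable_kern h1 h2 t₀ y le_rfl hw.le) Set.left_mem_uIcc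
      have := (hc 0 Set.left_mem_uIcc).tendsto
      rw [intervalIntegral.integral_same] at this
      refine this.mono_left ?_
      rw [Set.uIcc_of_le hw.le, ← nhdsWithin_Ioc_eq_nhdsGT hw]
      exact nhdsWithin_mono _ Set.Ioc_subset_Icc_self
  simpa using h

/-- The mean of the estimator, expressed through the sine integral. -/
lemma integral_score [IsProbabilityMeasure E.law] (h1 : E.OrdinarySmooth) (h2 : E.LocalBound)
    (F : Measure ℝ) [IsProbabilityMeasure F] (t₀ : ℝ) {l : ℝ} (hl : 1 ≤ l) :
    ∫ y, score E t₀ l y ∂(obsLaw E F) = 1 / Real.pi * ∫ x, sineInt (l * (x - t₀)) ∂F := by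
  unfold score
  rw [integral_const_mul]
  congr 1
  have hw := omegaOne_pos h2
  have hl0 : 0 < l := by linarith
  have hil : Integrable (fun y => ∫ ω in (0 : ℝ)..l, kern E t₀ y ω) (obsLaw E F) := by
    refine Integrable.of_bound (measurable_integral_kern t₀ 0 l).aestronglyMeasurable
      (Real.pi * (mBar E * l ^ E.β / 2)) (ae_of_all _ fun y => ?_)
    have := abs_score_le h1 h2 t₀ y hl
    rw [score, abs_mul, abs_of_pos (by positivity), one_div_mul_eq_div,
      div_le_iff₀' Real.pi_pos] at this
    exact this
  -- The exchange of integrals is made on $[\delta,l]$ only, as the bound of `abs_kern_le` is not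
  -- integrable at 0. The omitted pieces vanish as $\delta\to0$ by dominated convergence.
  have hkey : ∀ᶠ δ in 𝓝[>] (0 : ℝ),
      (∫ y, (∫ ω in (0 : ℝ)..l, kern E t₀ y ω) ∂(obsLaw E F)) -
        ∫ y, (∫ ω in (0 : ℝ)..δ, kern E t₀ y ω) ∂(obsLaw E F) =
      (∫ x, sineInt (l * (x - t₀)) ∂F) - ∫ x, sineInt (δ * (x - t₀)) ∂F := by
    filter_upwards [Ioc_mem_nhdsGT (lt_min hw hl0)] with δ hδ
    have hδw : δ ≤ omegaOne E := hδ.2.trans (min_le_left _ _)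
    have hid : Integrable (fun y => ∫ ω in (0 : ℝ)..δ, kern E t₀ y ω) (obsLaw E F) :=
      Integrable.of_bound (measurable_integral_kern t₀ 0 δ).aestronglyMeasurable
        (2 + 1 / E.τ) (ae_of_all _ fun y =>
          abs_integral_kern_near_le h1 h2 t₀ y le_rfl hw.le hδ.1.le hδw)
    rw [← integral_sub hil hid, ← integral_sub (integrable_sineInt F l t₀)
      (integrable_sineInt F δ t₀), ← integral_integral_kern h1 F t₀ hδ.1
      (hδ.2.trans (min_le_right _ _))]
    congr 1; ext y
    exact intervalIntegral.integral_interval_sub_left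
      (intervalIntegrable_kern h1 h2 t₀ y le_rfl hl0.le)
      (intervalIntegrable_kern h1 h2 t₀ y le_rfl hδ.1.le)
  have t1 := (tendsto_const_nhds (x := ∫ y, (∫ ω in (0 : ℝ)..l, kern E t₀ y ω) ∂(obsLaw E F))).sub
    (tendsto_integral_kern_zero h1 h2 F t₀)
  have t2 := (tendsto_const_nhds (x := ∫ x, sineInt (l * (x - t₀)) ∂F)).sub
    (tendsto_integral_sineInt_zero F t₀)
  have := tendsto_nhds_unique (t1.congr' hkey) t2
  simpa using this

lemma tendsto_integral_sineInt_atTop (F : Measure ℝ) [IsProbabilityMeasure F] (hF : F ≪ volume)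
    (t₀ : ℝ) :
    Filter.Tendsto (fun T => ∫ x, sineInt (T * (x - t₀)) ∂F) Filter.atTop
      (𝓝 (Real.pi / 2 - Real.pi * cdf F t₀)) := by
  have hg : ∫ x, (Real.pi / 2 - (Set.Iic t₀).indicator (fun _ => Real.pi) x) ∂F =
      Real.pi / 2 - Real.pi * cdf F t₀ := by
    rw [integral_sub (integrable_const _) ((integrable_const _).indicator measurableSet_Iic),
      integral_indicator measurableSet_Iic, cdf_eq_real]
    simp [mul_comm]
  rw [← hg]
  refine tendsto_integral_filter_of_dominated_convergence (fun _ => 2)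
    (Filter.Eventually.of_forall fun T => (integrable_sineInt F T t₀).aestronglyMeasurable)
    (Filter.Eventually.of_forall fun T => ae_of_all _ fun x => abs_sineInt_le _)
    (integrable_const _) ?_
  -- At $x=t_0$ the sine integral stays 0, which is not the required limit; absolute continuity
  -- makes this point null.
  have hne : ∀ᵐ x ∂F, x ≠ t₀ := hF.ae_le (compl_mem_ae_iff.2 (measure_singleton t₀))
  filter_upwards [hne] with x hx
  rcases lt_or_gt_of_ne hx with h | h
  · rw [Set.indicator_of_mem (show x ∈ Set.Iic t₀ from h.le)]
    have h3 : Filter.Tendsto (fun T : ℝ => T * (t₀ - x)) Filter.atTop Filter.atTop :=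
      Filter.tendsto_id.atTop_mul_const (by linarith)
    have := (tendsto_sineInt_atTop.comp h3).neg
    refine (this.congr fun T => ?_).trans_eq ?_
    · simp only [Function.comp]
      rw [← sineInt_neg]; congr 1; ring
    · congr 1; ring
  · rw [Set.indicator_of_notMem (by simpa using h), sub_zero]
    exact tendsto_sineInt_atTop.comp (Filter.tendsto_id.atTop_mul_const (by linarith))

lemma sobolevClass_integrable {α L : ℝ} {F : Measure ℝ} (hF : F ∈ sobolevClass α L) :
    Integrable (fun ω : ℝ => ‖charFun F ω‖ ^ 2 * (1 + ω ^ 2) ^ α) ∧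
      ∫ ω : ℝ, ‖charFun F ω‖ ^ 2 * (1 + ω ^ 2) ^ α ≤ 2 * Real.pi * L ^ 2 := by
  obtain ⟨hp, _, h⟩ := hF
  have hpi := Real.pi_pos
  have hnn : ∀ ω : ℝ, 0 ≤ ‖charFun F ω‖ ^ 2 * (1 + ω ^ 2) ^ α := fun ω => by positivity
  have hm : Measurable fun ω : ℝ => ‖charFun F ω‖ ^ 2 * (1 + ω ^ 2) ^ α := by
    have := measurable_charFun (μ := F)
    fun_prop
  set I := ∫⁻ ω : ℝ, ENNReal.ofReal (‖charFun F ω‖ ^ 2 * (1 + ω ^ 2) ^ α) with hI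
  have hle : I ≤ ENNReal.ofReal (2 * Real.pi * L ^ 2) := by
    have h3 : ENNReal.ofReal (2 * Real.pi) * (ENNReal.ofReal (1 / (2 * Real.pi)) * I) = I := by
      rw [← mul_assoc, ← ENNReal.ofReal_mul (by positivity),
        mul_one_div_cancel (by positivity), ENNReal.ofReal_one, one_mul]
    calc I = _ := h3.symm
      _ ≤ ENNReal.ofReal (2 * Real.pi) * ENNReal.ofReal (L ^ 2) := by gcongr
      _ = _ := (ENNReal.ofReal_mul (by positivity)).symm
  have hint : Integrable (fun ω : ℝ => ‖charFun F ω‖ ^ 2 * (1 + ω ^ 2) ^ α) := by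
    refine ⟨hm.aestronglyMeasurable, ?_⟩
    rw [hasFiniteIntegral_iff_ofReal (ae_of_all _ hnn)]
    exact hle.trans_lt ENNReal.ofReal_lt_top
  refine ⟨hint, ?_⟩
  rw [← ENNReal.ofReal_le_ofReal_iff (by positivity),
    ofReal_integral_eq_lintegral_ofReal hint (ae_of_all _ hnn)]
  exact hle

/-- The difference is the integral over $[l,T]$ of a function bounded by $\omega^{-1}|\hat
f(\omega)|$. Cauchy–Schwarz with weight $\omega^{2\alpha}\le(1+\omega^2)^\alpha$ gives the bound,
uniformly in $T$. -/
lemma abs_integral_sineInt_sub_le {α L : ℝ} (hα : 0 < α) (hL : 0 < L) {F : Measure ℝ}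
    (hF : F ∈ sobolevClass α L) (t₀ : ℝ) {l T : ℝ} (hl : 0 < l) (hT : l ≤ T) :
    |(∫ x, sineInt (T * (x - t₀)) ∂F) - ∫ x, sineInt (l * (x - t₀)) ∂F| ≤
      √(2 * Real.pi) * L * l ^ (-α - 1 / 2) := by
  have hpi := Real.pi_pos
  obtain ⟨hint, hle⟩ := sobolevClass_integrable hF
  have hp : IsProbabilityMeasure F := hF.1
  -- Cauchy–Schwarz is used as a weighted arithmetic–geometric mean inequality; this $c$ balances
  -- the two terms.
  set c := l ^ (-α - 1 / 2) / (√(2 * Real.pi) * L) with hc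
  have hpow : 0 < l ^ (-α - 1 / 2) := Real.rpow_pos_of_pos hl _
  have hc0 : 0 < c := by positivity
  rw [← integral_sub (integrable_sineInt F T t₀) (integrable_sineInt F l t₀),
    ← integral_integral_sin F t₀ hl hT]
  have hpt : ∀ ω ∈ Set.Ioc l T, ‖∫ x, ω⁻¹ * Real.sin (ω * (x - t₀)) ∂F‖ ≤
      c / 2 * (‖charFun F ω‖ ^ 2 * (1 + ω ^ 2) ^ α) + (2 * c)⁻¹ * ω ^ (-2 * α - 2) := by
    intro ω hω
    have hω0 : 0 < ω := hl.trans hω.1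
    have e1 : ‖∫ x, ω⁻¹ * Real.sin (ω * (x - t₀)) ∂F‖ ≤ ω⁻¹ * ‖charFun F ω‖ := by
      rw [integral_const_mul, norm_mul, norm_inv, Real.norm_of_nonneg hω0.le]
      gcongr
      simp_rw [show ∀ x, x - t₀ = -t₀ + x from fun x => by ring]
      rw [← im_exp_mul_charFun]
      refine (Complex.abs_im_le_norm _).trans_eq ?_
      rw [norm_mul, show Complex.I * ω * ((-t₀ : ℝ) : ℂ) = ((ω * (-t₀) : ℝ) : ℂ) * Complex.I by
        push_cast; ring, Complex.norm_exp_ofReal_mul_I, one_mul]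
    refine e1.trans ?_
    set p := ‖charFun F ω‖
    have e2 : (ω ^ α) ^ 2 ≤ (1 + ω ^ 2) ^ α := by
      rw [← Real.rpow_natCast, ← Real.rpow_mul hω0.le, mul_comm, Real.rpow_mul hω0.le]
      refine Real.rpow_le_rpow (by positivity) ?_ hα.le
      rw [Real.rpow_natCast]; linarith
    have e3 : ω ^ (-2 * α - 2) = ((ω ^ α)⁻¹ * ω⁻¹) ^ 2 := by
      rw [← Real.rpow_neg hω0.le, ← Real.rpow_neg_one, ← Real.rpow_add hω0, ← Real.rpow_natCast,
        ← Real.rpow_mul hω0.le]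
      congr 1; push_cast; ring
    have e4 : ω⁻¹ * p = (p * ω ^ α) * ((ω ^ α)⁻¹ * ω⁻¹) := by field_simp
    have e5 : c / 2 * (p ^ 2 * (ω ^ α) ^ 2) ≤ c / 2 * (p ^ 2 * (1 + ω ^ 2) ^ α) := by gcongr
    rw [e3, e4]
    refine le_trans ?_ (add_le_add_left e5 _)
    generalize (ω ^ α)⁻¹ * ω⁻¹ = v
    rw [← mul_pow]
    generalize p * ω ^ α = w
    have : c / 2 * w ^ 2 + (2 * c)⁻¹ * v ^ 2 - w * v = (c * w - v) ^ 2 / (2 * c) := by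
      field_simp; ring
    have : 0 ≤ (c * w - v) ^ 2 / (2 * c) := by positivity
    linarith
  have hi1 : IntervalIntegrable (fun ω : ℝ => ‖charFun F ω‖ ^ 2 * (1 + ω ^ 2) ^ α) volume l T :=
    hint.intervalIntegrable
  have hi2 : IntervalIntegrable (fun ω : ℝ => ω ^ (-2 * α - 2)) volume l T :=
    intervalIntegral.intervalIntegrable_rpow (Or.inr (by
      rw [Set.uIcc_of_le hT]; exact fun h => absurd h.1 (not_le.2 hl)))
  have hb := intervalIntegral.norm_integral_le_of_norm_le (μ := volume) hT
    (f := fun ω => ∫ x, ω⁻¹ * Real.sin (ω * (x - t₀)) ∂F) (ae_of_all _ hpt)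
    ((hi1.const_mul (c / 2)).add (hi2.const_mul (2 * c)⁻¹))
  refine hb.trans ?_
  rw [intervalIntegral.integral_add (hi1.const_mul _) (hi2.const_mul _),
    intervalIntegral.integral_const_mul, intervalIntegral.integral_const_mul]
  have b1 : ∫ ω in l..T, ‖charFun F ω‖ ^ 2 * (1 + ω ^ 2) ^ α ≤ 2 * Real.pi * L ^ 2 := by
    rw [intervalIntegral.integral_of_le hT]
    exact (setIntegral_le_integral hint (ae_of_all _ fun ω => by positivity)).trans hle
  have b2 : ∫ ω in l..T, ω ^ (-2 * α - 2) ≤ (l ^ (-α - 1 / 2)) ^ 2 := by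
    rw [integral_rpow (Or.inr ⟨by linarith, by
      rw [Set.uIcc_of_le hT]; exact fun h => absurd h.1 (not_le.2 hl)⟩)]
    have e1 : (l ^ (-α - 1 / 2)) ^ 2 = l ^ (-2 * α - 2 + 1) := by
      rw [← Real.rpow_natCast, ← Real.rpow_mul hl.le]
      congr 1; push_cast; ring
    rw [e1]
    have e2 : 0 < T ^ (-2 * α - 2 + 1) := Real.rpow_pos_of_pos (hl.trans_le hT) _
    have e3 : 0 < l ^ (-2 * α - 2 + 1) := Real.rpow_pos_of_pos hl _
    rw [div_le_iff_of_neg (by linarith)]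
    nlinarith
  have hs : √(2 * Real.pi) ^ 2 = 2 * Real.pi := Real.sq_sqrt (by positivity)
  have hs0 : 0 < √(2 * Real.pi) := by positivity
  calc _ ≤ c / 2 * (2 * Real.pi * L ^ 2) + (2 * c)⁻¹ * (l ^ (-α - 1 / 2)) ^ 2 := by gcongr
    _ = _ := by
        generalize √(2 * Real.pi) = r at *
        rw [← hs, hc]
        field_simp
        ring

lemma abs_cdf_sub_le [IsProbabilityMeasure E.law] (h1 : E.OrdinarySmooth) (h2 : E.LocalBound)
    {α L : ℝ} (hα : 0 < α) (hL : 0 < L) {F : Measure ℝ} (hF : F ∈ sobolevClass α L) (t₀ : ℝ)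
    {l : ℝ} (hl : 1 ≤ l) :
    |1 / 2 - ∫ y, score E t₀ l y ∂(obsLaw E F) - cdf F t₀| ≤
      √2 * (√Real.pi)⁻¹ * L * l ^ (-α - 1 / 2) := by
  have hp : IsProbabilityMeasure F := hF.1
  have hpi := Real.pi_pos
  rw [integral_score h1 h2 F t₀ hl]
  set B := ∫ x, sineInt (l * (x - t₀)) ∂F
  have h3 : |Real.pi / 2 - Real.pi * cdf F t₀ - B| ≤ √(2 * Real.pi) * L * l ^ (-α - 1 / 2) := by
    refine le_of_tendsto ((tendsto_integral_sineInt_atTop F hF.2.1 t₀).sub_const B).abs ?_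
    filter_upwards [Filter.eventually_ge_atTop l] with T hT
    exact abs_integral_sineInt_sub_le hα hL hF t₀ (by linarith) hT
  have h4 : 1 / 2 - 1 / Real.pi * B - cdf F t₀ =
      Real.pi⁻¹ * (Real.pi / 2 - Real.pi * cdf F t₀ - B) := by field_simp; ring
  rw [h4, abs_mul, abs_of_pos (by positivity)]
  calc _ ≤ Real.pi⁻¹ * (√(2 * Real.pi) * L * l ^ (-α - 1 / 2)) := by gcongr
    _ = _ := by
        have : Real.pi = √Real.pi * √Real.pi := (Real.mul_self_sqrt hpi.le).symm
        rw [Real.sqrt_mul (by norm_num)]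
        nth_rewrite 1 [this]
        field_simp

/-! ### Deviations of the estimator and of the empirical variance. -/

lemma cdfEst_eq (E : ErrorModel) {n : ℕ} (t₀ l : ℝ) (y : Fin n → ℝ) :
    cdfEst E t₀ l y = 1 / 2 - (n : ℝ)⁻¹ * ∑ j, score E t₀ l (y j) := by
  rw [cdfEst, one_div (n : ℝ)]; rfl

lemma cStar_pos (h2 : E.LocalBound) : 0 < cStar E := by
  have := h2.2.2.1
  have := Real.pi_pos
  unfold cStar
  positivity

lemma sigmaTildeSq_eq (E : ErrorModel) {n : ℕ} (t₀ l : ℝ) (y : Fin n → ℝ) :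
    sigmaTildeSq E t₀ y l = cStar E + 2 * ((n : ℝ)⁻¹ * ∑ j, tailScore E t₀ l (y j) ^ 2) := by
  have h : ∀ j, ∫ ω in omegaOne E..l, ∫ μ in omegaOne E..l,
      kern E t₀ (y j) ω * kern E t₀ (y j) μ = Real.pi ^ 2 * tailScore E t₀ l (y j) ^ 2 := by
    intro j
    simp_rw [intervalIntegral.integral_const_mul, intervalIntegral.integral_mul_const]
    rw [tailScore]; field_simp
  rw [sigmaTildeSq]
  simp_rw [h]
  rw [← Finset.mul_sum]
  congr 1
  field_simp

lemma sigmaSq_eq (E : ErrorModel) (t₀ : ℝ) (F : Measure ℝ) (l : ℝ) :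
    sigmaSq E t₀ F l = cStar E + 2 * ∫ y, tailScore E t₀ l y ^ 2 ∂(obsLaw E F) := by
  unfold sigmaSq tailScore
  simp_rw [mul_pow]
  rw [integral_const_mul]
  ring

lemma sigmaSq_pos (h2 : E.LocalBound) (t₀ : ℝ) (F : Measure ℝ) (l : ℝ) :
    0 < sigmaSq E t₀ F l := by
  have := cStar_pos h2
  have : 0 ≤ ∫ y, tailScore E t₀ l y ^ 2 ∂(obsLaw E F) := integral_nonneg fun y => sq_nonneg _
  rw [sigmaSq_eq]
  positivity

/-- The scale of the fluctuations at bandwidth `l` and confidence level `exp (-u)`. -/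
noncomputable def devScale (E : ErrorModel) (n : ℕ) (u l : ℝ) : ℝ :=
  mBar E * l ^ E.β / 2 * √(u / n)

lemma devScale_sq (E : ErrorModel) {n : ℕ} {u : ℝ} (hu : 0 ≤ u) (l : ℝ) :
    devScale E n u l ^ 2 = (mBar E * l ^ E.β) ^ 2 / 4 * (u / n) := by
  rw [devScale, mul_pow, Real.sq_sqrt (by positivity)]; ring

theorem sampleLaw_cdfEst_deviation_le [IsProbabilityMeasure E.law] (h1 : E.OrdinarySmooth)
    (h2 : E.LocalBound) (F : Measure ℝ) [IsProbabilityMeasure F] (t₀ : ℝ) {n : ℕ} (hn : 1 ≤ n)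
    {l u : ℝ} (hl : 1 ≤ l) (hu : 0 < u) :
    sampleLaw E n F {y | √u * (√2 * √(sigmaSq E t₀ F l) + 2 / 3 * devScale E n u l) * (√n)⁻¹ <
      |cdfEst E t₀ l y - (1 / 2 - ∫ y, score E t₀ l y ∂(obsLaw E F))|} ≤
      ENNReal.ofReal (2 * Real.exp (-u)) := by
  have hn0 : (0 : ℝ) < n := by exact_mod_cast hn
  have hb : ∀ y, |score E t₀ l y| ≤ mBar E * l ^ E.β / 2 := fun y => abs_score_le h1 h2 t₀ y hl
  have ht : ∀ y, |tailScore E t₀ l y| ≤ mBar E * l ^ E.β / 2 :=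
    fun y => abs_tailScore_le h1 h2 t₀ y hl
  have hms := measurable_score (E := E) t₀ l
  have hmt := measurable_tailScore (E := E) t₀ l
  have hs := sigmaSq_pos h2 t₀ F l
  have hfi : Integrable (score E t₀ l) (obsLaw E F) :=
    Integrable.of_bound hms.aestronglyMeasurable _ (ae_of_all _ hb)
  have hf2 : Integrable (fun y => score E t₀ l y ^ 2) (obsLaw E F) :=
    Integrable.of_bound (hms.pow_const 2).aestronglyMeasurable ((mBar E * l ^ E.β / 2) ^ 2)
      (ae_of_all _ fun y => by
        rw [norm_pow]; exact pow_le_pow_left₀ (abs_nonneg _) (hb y) 2)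
  have ht2 : Integrable (fun y => tailScore E t₀ l y ^ 2) (obsLaw E F) :=
    Integrable.of_bound (hmt.pow_const 2).aestronglyMeasurable ((mBar E * l ^ E.β / 2) ^ 2)
      (ae_of_all _ fun y => by
        rw [norm_pow]; exact pow_le_pow_left₀ (abs_nonneg _) (ht y) 2)
  have hmean : |∫ y, score E t₀ l y ∂(obsLaw E F)| ≤ mBar E * l ^ E.β / 2 := by
    simpa using norm_integral_le_of_norm_le_const (μ := obsLaw E F) (f := score E t₀ l)
      (ae_of_all _ hb)
  have hv : ∫ y, score E t₀ l y ^ 2 ∂(obsLaw E F) ≤ sigmaSq E t₀ F l := by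
    rw [sigmaSq_eq]
    calc _ ≤ ∫ y, (cStar E + 2 * tailScore E t₀ l y ^ 2) ∂(obsLaw E F) :=
          integral_mono hf2 (by fun_prop) fun y => score_sq_le h1 h2 t₀ y hl
      _ = _ := by rw [integral_add (by fun_prop) (by fun_prop), integral_const_mul]; simp
  have := bernstein_mean (obsLaw E F) hn hms (M := mBar E * l ^ E.β)
    (fun y => (abs_sub _ _).trans (by linarith [hb y])) hfi hf2 hs hv hu
  refine le_trans (measure_mono fun y hy => ?_) this
  simp only [Set.mem_ofPred_eq] at hy ⊢
  have e1 : cdfEst E t₀ l y - (1 / 2 - ∫ y, score E t₀ l y ∂(obsLaw E F)) =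
      -((n : ℝ)⁻¹ * ∑ j, score E t₀ l (y j) - ∫ y, score E t₀ l y ∂(obsLaw E F)) := by
    rw [cdfEst_eq]; ring
  rw [e1, abs_neg] at hy
  refine lt_of_eq_of_lt ?_ hy
  have e2 : √u * √u = u := Real.mul_self_sqrt hu.le
  have e3 : √(n : ℝ) * √n = n := Real.mul_self_sqrt hn0.le
  have e4 : 0 < √(n : ℝ) := Real.sqrt_pos.2 hn0
  rw [devScale, Real.sqrt_div hu.le, Real.sqrt_div (by positivity), Real.sqrt_mul (by positivity),
    Real.sqrt_mul (by norm_num)]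
  have e5 : u / (3 * n) = √u * √u / (3 * (√n * √n)) := by rw [e2, e3]
  rw [mul_div_assoc _ u, e5]
  field_simp

theorem sampleLaw_sigmaTildeSq_deviation_le [IsProbabilityMeasure E.law] (h1 : E.OrdinarySmooth)
    (h2 : E.LocalBound) (F : Measure ℝ) [IsProbabilityMeasure F] (t₀ : ℝ) {n : ℕ} (hn : 1 ≤ n)
    {l u : ℝ} (hl : 1 ≤ l) (hu : 0 < u) :
    sampleLaw E n F {y | 2 * devScale E n u l * √(sigmaSq E t₀ F l) +
        2 / 3 * devScale E n u l ^ 2 < |sigmaTildeSq E t₀ y l - sigmaSq E t₀ F l|} ≤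
      ENNReal.ofReal (2 * Real.exp (-u)) := by
  have hn0 : (0 : ℝ) < n := by exact_mod_cast hn
  set M := mBar E * l ^ E.β with hM
  have hM0 : 0 < M := mul_pos (mBar_pos h1 h2) (Real.rpow_pos_of_pos (by linarith) _)
  have ht : ∀ y, tailScore E t₀ l y ^ 2 ≤ M ^ 2 / 4 := fun y => by
    have := pow_le_pow_left₀ (abs_nonneg _) (abs_tailScore_le h1 h2 t₀ y hl) 2
    rw [sq_abs, div_pow] at this
    linarith
  have hmt := (measurable_tailScore (E := E) t₀ l).pow_const 2
  have hs := sigmaSq_pos h2 t₀ F l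
  have hfi : Integrable (fun y => tailScore E t₀ l y ^ 2) (obsLaw E F) :=
    Integrable.of_bound hmt.aestronglyMeasurable (M ^ 2 / 4) (ae_of_all _ fun y => by
      rw [Real.norm_of_nonneg (sq_nonneg _)]; exact ht y)
  have hf2 : Integrable (fun y => (tailScore E t₀ l y ^ 2) ^ 2) (obsLaw E F) :=
    Integrable.of_bound (hmt.pow_const 2).aestronglyMeasurable ((M ^ 2 / 4) ^ 2)
      (ae_of_all _ fun y => by
        rw [Real.norm_of_nonneg (sq_nonneg _)]
        exact pow_le_pow_left₀ (sq_nonneg _) (ht y) 2)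
  have hm0 : 0 ≤ ∫ y, tailScore E t₀ l y ^ 2 ∂(obsLaw E F) := integral_nonneg fun y => sq_nonneg _
  have hm1 : ∫ y, tailScore E t₀ l y ^ 2 ∂(obsLaw E F) ≤ M ^ 2 / 4 := by
    calc _ ≤ ∫ _, M ^ 2 / 4 ∂(obsLaw E F) := integral_mono hfi (integrable_const _) ht
      _ = _ := by simp
  -- The fourth moment is at most the squared supremum times the second moment, so the variance
  -- estimate fluctuates on a scale proportional to $\sigma_l$ itself.
  have hv : ∫ y, (tailScore E t₀ l y ^ 2) ^ 2 ∂(obsLaw E F) ≤ M ^ 2 / 8 * sigmaSq E t₀ F l := by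
    calc _ ≤ ∫ y, M ^ 2 / 4 * tailScore E t₀ l y ^ 2 ∂(obsLaw E F) := by
          refine integral_mono hf2 (by fun_prop) fun y => ?_
          simp only
          rw [sq (tailScore E t₀ l y ^ 2)]
          exact mul_le_mul_of_nonneg_right (ht y) (sq_nonneg _)
      _ = M ^ 2 / 4 * ∫ y, tailScore E t₀ l y ^ 2 ∂(obsLaw E F) := integral_const_mul _ _
      _ ≤ _ := by
          have := cStar_pos h2
          rw [sigmaSq_eq]
          nlinarith [sq_pos_of_pos hM0]
  have := bernstein_mean (obsLaw E F) hn hmt (M := M ^ 2 / 4) (fun y => by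
    rw [abs_le]; constructor <;> linarith [ht y, sq_nonneg (tailScore E t₀ l y)])
    hfi hf2 (by positivity) hv hu
  refine le_trans (measure_mono fun y hy => ?_) this
  simp only [Set.mem_ofPred_eq] at hy ⊢
  have e1 : sigmaTildeSq E t₀ y l - sigmaSq E t₀ F l =
      2 * ((n : ℝ)⁻¹ * ∑ j, tailScore E t₀ l (y j) ^ 2 -
        ∫ y, tailScore E t₀ l y ^ 2 ∂(obsLaw E F)) := by
    rw [sigmaTildeSq_eq, sigmaSq_eq]; ring
  rw [e1, abs_mul, abs_two, devScale_sq E hu.le, ← hM] at hy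
  have e2 : √(2 * (M ^ 2 / 8 * sigmaSq E t₀ F l) * u / n) =
      devScale E n u l * √(sigmaSq E t₀ F l) := by
    rw [show 2 * (M ^ 2 / 8 * sigmaSq E t₀ F l) * u / n = (M / 2) ^ 2 * (u / n) * sigmaSq E t₀ F l
      by ring, Real.sqrt_mul (by positivity), Real.sqrt_mul (by positivity),
      Real.sqrt_sq (by positivity), devScale]
  rw [e2]
  have e3 : 2 / 3 * (M ^ 2 / 4 * (u / n)) = 2 * (M ^ 2 / 4 * u / (3 * n)) := by field_simp
  linarith

/-- The event that the estimators and the empirical variances at the bandwidth `l` are close to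
their means. -/
def IsGood (E : ErrorModel) {n : ℕ} (t₀ u : ℝ) (F : Measure ℝ) (l : ℝ) (y : Fin n → ℝ) : Prop :=
  |cdfEst E t₀ l y - (1 / 2 - ∫ y, score E t₀ l y ∂(obsLaw E F))| ≤
      √u * (√2 * √(sigmaSq E t₀ F l) + 2 / 3 * devScale E n u l) * (√n)⁻¹ ∧
    |sigmaTildeSq E t₀ y l - sigmaSq E t₀ F l| ≤
      2 * devScale E n u l * √(sigmaSq E t₀ F l) + 2 / 3 * devScale E n u l ^ 2

/-- Two two-sided events at each of $N$ points, each tail of size $e^{-u}=\epsilon/(4N)$. -/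
theorem sampleLaw_not_isGood_le [IsProbabilityMeasure E.law] (h1 : E.OrdinarySmooth)
    (h2 : E.LocalBound) (F : Measure ℝ) [IsProbabilityMeasure F] (t₀ : ℝ) {n N : ℕ} (hn : 1 ≤ n)
    (hN : 1 ≤ N) {lam : ℕ → ℝ} (hlam : ∀ l ∈ grid N lam, 1 ≤ l) {ε : ℝ} (hε : 0 < ε)
    (hu : 0 < Real.log (4 * N / ε)) :
    sampleLaw E n F {y | ¬ ∀ l ∈ grid N lam, IsGood E t₀ (Real.log (4 * N / ε)) F l y} ≤
      ENNReal.ofReal ε := by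
  set u := Real.log (4 * N / ε)
  have hN0 : (0 : ℝ) < N := by exact_mod_cast hN
  have hexp : Real.exp (-u) = ε / (4 * N) := by
    rw [Real.exp_neg, Real.exp_log (by positivity), inv_div]
  have hone : ∀ j ∈ Finset.Icc 1 N, sampleLaw E n F {y | ¬ IsGood E t₀ u F (lam j) y} ≤
      ENNReal.ofReal (ε / N) := by
    intro j hj
    have hl := hlam (lam j) ⟨j, Finset.mem_Icc.1 hj, rfl⟩
    have h3 := add_le_add (sampleLaw_cdfEst_deviation_le h1 h2 F t₀ hn hl hu)
      (sampleLaw_sigmaTildeSq_deviation_le h1 h2 F t₀ hn hl hu)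
    rw [← ENNReal.ofReal_add (by positivity) (by positivity), hexp,
      show 2 * (ε / (4 * N)) + 2 * (ε / (4 * N)) = ε / N by field_simp; norm_num] at h3
    refine le_trans (measure_mono fun y hy => ?_) ((measure_union_le _ _).trans h3)
    simp only [Set.mem_union, Set.mem_ofPred_eq]
    rw [← not_le, ← not_le, ← not_and_or]
    exact hy
  have hsub : {y : Fin n → ℝ | ¬ ∀ l ∈ grid N lam, IsGood E t₀ u F l y} ⊆
      ⋃ j ∈ Finset.Icc 1 N, {y | ¬ IsGood E t₀ u F (lam j) y} := by
    intro y hy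
    simp only [Set.mem_ofPred_eq, not_forall] at hy
    obtain ⟨_, ⟨j, hj, rfl⟩, hy⟩ := hy
    exact Set.mem_biUnion (Finset.mem_Icc.2 hj) hy
  refine (measure_mono hsub).trans ((measure_biUnion_finset_le _ _).trans ?_)
  refine (Finset.sum_le_sum hone).trans_eq ?_
  rw [Finset.sum_const, Nat.card_Icc, Nat.add_sub_cancel, nsmul_eq_mul, ← ENNReal.ofReal_natCast,
    ← ENNReal.ofReal_mul hN0.le, mul_div_cancel₀ _ hN0.ne']

/-! ### Lacunary grids and monotonicity of the scales. -/

lemma finite_grid (N : ℕ) (lam : ℕ → ℝ) : (grid N lam).Finite := (Set.finite_Icc 1 N).image _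

/-- A grid with values in `[1, ∞)`, any two points of which differ by a factor of at least two. -/
structure IsLacunary (Λ : Set ℝ) : Prop where
  finite : Λ.Finite
  one_le : ∀ l ∈ Λ, 1 ≤ l
  two_mul_le : ∀ l ∈ Λ, ∀ m ∈ Λ, l < m → 2 * l ≤ m

lemma isLacunary_grid {N : ℕ} {lam : ℕ → ℝ} (hmin : 1 ≤ lam 1)
    (hstep : ∀ j : ℕ, 1 ≤ j → j < N → 2 * lam j ≤ lam (j + 1)) : IsLacunary (grid N lam) := by
  have hone : ∀ j, 1 ≤ j → j ≤ N → 1 ≤ lam j := by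
    intro j hj
    induction j, hj using Nat.le_induction with
    | base => exact fun _ => hmin
    | succ k hk ih => intro hN; linarith [hstep k hk (by omega), ih (by omega)]
  have hmul : ∀ i j, 1 ≤ i → i < j → j ≤ N → 2 * lam i ≤ lam j := by
    intro i j hi hij
    induction j, hij using Nat.le_induction with
    | base => exact fun hN => hstep i hi (by omega)
    | succ k hk ih =>
      intro hN
      linarith [hstep k (by omega) (by omega), ih (by omega), hone k (by omega) (by omega)]
  refine ⟨finite_grid N lam, ?_, ?_⟩
  · rintro _ ⟨j, hj, rfl⟩
    exact hone j hj.1 hj.2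
  · rintro _ ⟨i, hi, rfl⟩ _ ⟨j, hj, rfl⟩ hlt
    rcases lt_trichotomy i j with h | h | h
    · exact hmul i j hi.1 h hj.2
    · rw [h] at hlt; exact absurd hlt (lt_irrefl _)
    · linarith [hmul j i hj.1 h hi.2, hone j hj.1 hj.2]

section GridMax

variable {Λ : Set ℝ} {g : ℝ → ℝ} {l m : ℝ}

lemma le_gridMax (hΛ : Λ.Finite) (hm : m ∈ Λ) (hml : m ≤ l) : g m ≤ gridMax Λ g l :=
  le_csSup ((hΛ.subset fun _ h => h.1).image g).bddAbove ⟨m, ⟨hm, hml⟩, rfl⟩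

lemma exists_gridMax_eq (hΛ : Λ.Finite) (hl : l ∈ Λ) :
    ∃ m ∈ Λ, m ≤ l ∧ gridMax Λ g l = g m := by
  have hne : (g '' {μ | μ ∈ Λ ∧ μ ≤ l}).Nonempty := ⟨g l, l, ⟨hl, le_rfl⟩, rfl⟩
  obtain ⟨m, hm, h⟩ := hne.csSup_mem ((hΛ.subset fun _ h => h.1).image g)
  exact ⟨m, hm.1, hm.2, h.symm⟩

lemma gridMax_mono (hΛ : Λ.Finite) (hl : l ∈ Λ) (hlm : l ≤ m) :
    gridMax Λ g l ≤ gridMax Λ g m := by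
  obtain ⟨k, hk, hkl, h⟩ := exists_gridMax_eq (g := g) hΛ hl
  rw [h]
  exact le_gridMax hΛ hk (hkl.trans hlm)

end GridMax

lemma gridMax_sigmaSq_nonneg (h2 : E.LocalBound) (t₀ : ℝ) (F : Measure ℝ) {Λ : Set ℝ}
    (hΛ : Λ.Finite) {l : ℝ} (hl : l ∈ Λ) : 0 ≤ gridMax Λ (sigmaSq E t₀ F) l :=
  (sigmaSq_pos h2 t₀ F l).le.trans (le_gridMax hΛ hl le_rfl)

lemma gridMax_sigmaTildeSq_nonneg (h2 : E.LocalBound) (t₀ : ℝ) {n : ℕ} (y : Fin n → ℝ) {Λ : Set ℝ}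
    (hΛ : Λ.Finite) {l : ℝ} (hl : l ∈ Λ) : 0 ≤ gridMax Λ (sigmaTildeSq E t₀ y) l := by
  refine le_trans ?_ (le_gridMax hΛ hl le_rfl)
  have := cStar_pos h2
  rw [sigmaTildeSq_eq]
  positivity

lemma devScale_nonneg (h1 : E.OrdinarySmooth) (h2 : E.LocalBound) (n : ℕ) (u : ℝ) {l : ℝ}
    (hl : 0 ≤ l) : 0 ≤ devScale E n u l := by
  have := mBar_pos h1 h2
  unfold devScale
  positivity

lemma devScale_mono (h1 : E.OrdinarySmooth) (h2 : E.LocalBound) (n : ℕ) (u : ℝ) {l m : ℝ}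
    (hl : 0 ≤ l) (hlm : l ≤ m) : devScale E n u l ≤ devScale E n u m := by
  have := mBar_pos h1 h2
  have := h1.1
  unfold devScale
  gcongr

/-- The use of $\beta>1/2$: passing to a larger grid point gains at least $2^\beta\ge\sqrt2$, hence
2 after squaring. -/
lemma sqrt_two_mul_rpow_le {β l m : ℝ} (hβ : 1 / 2 < β) (hl : 0 ≤ l) (hlm : 2 * l ≤ m) :
    √2 * l ^ β ≤ m ^ β := by
  calc √2 * l ^ β ≤ 2 ^ β * l ^ β := by
        rw [Real.sqrt_eq_rpow]; gcongr; norm_num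
    _ = (2 * l) ^ β := (Real.mul_rpow (by norm_num) hl).symm
    _ ≤ m ^ β := Real.rpow_le_rpow (by positivity) hlm (by linarith)

lemma sqrt_two_mul_devScale_le (h1 : E.OrdinarySmooth) (h2 : E.LocalBound) (hβ : 1 / 2 < E.β)
    (n : ℕ) (u : ℝ) {l m : ℝ} (hl : 0 ≤ l) (hlm : 2 * l ≤ m) :
    √2 * devScale E n u l ≤ devScale E n u m := by
  have := mBar_pos h1 h2
  calc √2 * devScale E n u l = mBar E * (√2 * l ^ E.β) / 2 * √(u / n) := by rw [devScale]; ring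
    _ ≤ devScale E n u m := by
        unfold devScale
        gcongr
        exact sqrt_two_mul_rpow_le hβ hl hlm

lemma penalty_eq (E : ErrorModel) (n N : ℕ) (ε : ℝ) {l : ℝ} (hl : 0 ≤ l) :
    penalty E n N ε l =
      11 * mBar E ^ 2 * (l ^ E.β) ^ 2 * (n : ℝ)⁻¹ * Real.log (4 * (N : ℝ) ^ 2 / ε) := by
  rw [penalty, mul_comm 2 E.β, Real.rpow_mul hl, Real.rpow_two]

/-! ### Deterministic analysis on the favourable event. -/

section Confidence

variable {n N : ℕ} {ε : ℝ}

lemma log_level_pos (hN : 1 ≤ N) (hε₀ : 0 < ε) (hε : ε < 1 / 2) : 0 < Real.log (4 * N / ε) := by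
  have hN' : (1 : ℝ) ≤ N := by exact_mod_cast hN
  refine Real.log_pos ?_
  rw [one_lt_div hε₀]
  linarith

lemma log_level_le (hN : 1 ≤ N) (hε₀ : 0 < ε) :
    Real.log (4 * N / ε) ≤ Real.log (4 * (N : ℝ) ^ 2 / ε) := by
  have hN' : (1 : ℝ) ≤ N := by exact_mod_cast hN
  refine Real.log_le_log (by positivity) ?_
  gcongr
  nlinarith

lemma devScale_sq_le_penalty (hN : 1 ≤ N) (hε₀ : 0 < ε) (hε : ε < 1 / 2) {l : ℝ} (hl : 0 ≤ l) :
    44 * devScale E n (Real.log (4 * N / ε)) l ^ 2 ≤ penalty E n N ε l := by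
  rw [penalty_eq E n N ε hl, devScale_sq E (log_level_pos hN hε₀ hε).le]
  have := log_level_le hN hε₀
  calc _ = 11 * mBar E ^ 2 * (l ^ E.β) ^ 2 * (n : ℝ)⁻¹ * Real.log (4 * N / ε) := by ring
    _ ≤ _ := by gcongr

lemma penalty_le_half (hβ : 1 / 2 < E.β) (hN : 1 ≤ N) (hε₀ : 0 < ε) (hε : ε < 1 / 2) {l m : ℝ}
    (hl : 0 ≤ l) (hlm : 2 * l ≤ m) : penalty E n N ε l ≤ penalty E n N ε m / 2 := by
  rw [penalty_eq E n N ε hl, penalty_eq E n N ε (by linarith)]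
  have hx := (log_level_pos hN hε₀ hε).trans_le (log_level_le hN hε₀)
  have h3 := pow_le_pow_left₀ (by positivity) (sqrt_two_mul_rpow_le hβ hl hlm) 2
  rw [mul_pow, Real.sq_sqrt (by norm_num)] at h3
  calc _ ≤ 11 * mBar E ^ 2 * ((m ^ E.β) ^ 2 / 2) * (n : ℝ)⁻¹ *
        Real.log (4 * (N : ℝ) ^ 2 / ε) := by gcongr; linarith
    _ = _ := by ring

lemma penalty_nonneg (hN : 1 ≤ N) (hε₀ : 0 < ε) (hε : ε < 1 / 2) {l : ℝ} (hl : 0 ≤ l) :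
    0 ≤ penalty E n N ε l :=
  le_trans (by positivity) (devScale_sq_le_penalty hN hε₀ hε hl)

lemma penalty_mono (hE : 0 < E.β) (hN : 1 ≤ N) (hε₀ : 0 < ε) (hε : ε < 1 / 2) {l m : ℝ}
    (hl : 0 ≤ l) (hlm : l ≤ m) : penalty E n N ε l ≤ penalty E n N ε m := by
  have hx := (log_level_pos hN hε₀ hε).trans_le (log_level_le hN hε₀)
  unfold penalty
  gcongr

variable {t₀ : ℝ} {Λ : Set ℝ} {F : Measure ℝ} {y : Fin n → ℝ}

lemma vOracle_sq (h2 : E.LocalBound) (hN : 1 ≤ N) (hε₀ : 0 < ε) (hε : ε < 1 / 2)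
    (hΛ : IsLacunary Λ) {l : ℝ} (hl : l ∈ Λ) :
    vOracle E n N ε t₀ Λ F l ^ 2 = √(gridMax Λ (sigmaSq E t₀ F) l) ^ 2 + penalty E n N ε l := by
  have hl0 : 0 ≤ l := zero_le_one.trans (hΛ.one_le l hl)
  have h3 := gridMax_sigmaSq_nonneg h2 t₀ F hΛ.finite hl
  rw [vOracle, Real.sq_sqrt h3, Real.sq_sqrt (add_nonneg h3 (penalty_nonneg hN hε₀ hε hl0))]

lemma vTilde_sq (h2 : E.LocalBound) (hN : 1 ≤ N) (hε₀ : 0 < ε) (hε : ε < 1 / 2)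
    (hΛ : IsLacunary Λ) {l : ℝ} (hl : l ∈ Λ) :
    vTilde E N ε t₀ Λ y l ^ 2 = gridMax Λ (sigmaTildeSq E t₀ y) l + penalty E n N ε l := by
  have hl0 : 0 ≤ l := zero_le_one.trans (hΛ.one_le l hl)
  exact Real.sq_sqrt (add_nonneg (gridMax_sigmaTildeSq_nonneg h2 t₀ y hΛ.finite hl)
    (penalty_nonneg hN hε₀ hε hl0))

lemma vOracle_pos (h2 : E.LocalBound) (hN : 1 ≤ N) (hε₀ : 0 < ε) (hε : ε < 1 / 2)
    (hΛ : IsLacunary Λ) {l : ℝ} (hl : l ∈ Λ) : 0 < vOracle E n N ε t₀ Λ F l := by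
  have hl0 : 0 ≤ l := zero_le_one.trans (hΛ.one_le l hl)
  refine Real.sqrt_pos.2 (add_pos_of_pos_of_nonneg ?_ (penalty_nonneg hN hε₀ hε hl0))
  exact (sigmaSq_pos h2 t₀ F l).trans_le (le_gridMax hΛ.finite hl le_rfl)

lemma vOracle_mono (hE : 0 < E.β) (hN : 1 ≤ N) (hε₀ : 0 < ε) (hε : ε < 1 / 2)
    (hΛ : IsLacunary Λ) {l m : ℝ} (hl : l ∈ Λ) (hlm : l ≤ m) :
    vOracle E n N ε t₀ Λ F l ≤ vOracle E n N ε t₀ Λ F m := by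
  have hl0 : 0 ≤ l := zero_le_one.trans (hΛ.one_le l hl)
  exact Real.sqrt_le_sqrt (add_le_add (gridMax_mono hΛ.finite hl hlm)
    (penalty_mono hE hN hε₀ hε hl0 hlm))

/-- The deviation bound at $m\le l$ is at most the one formed with $l$ and the maximal variance. A
uniform bound on differences carries over to maxima by evaluating at either maximiser. -/
lemma gridMax_sigmaTildeSq_bounds (h1 : E.OrdinarySmooth) (h2 : E.LocalBound) (hΛ : IsLacunary Λ)
    {u : ℝ} (hy : ∀ l ∈ Λ, IsGood E t₀ u F l y) {l : ℝ} (hl : l ∈ Λ) :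
    |gridMax Λ (sigmaTildeSq E t₀ y) l - √(gridMax Λ (sigmaSq E t₀ F) l) ^ 2| ≤
      2 * devScale E n u l * √(gridMax Λ (sigmaSq E t₀ F) l) + 2 / 3 * devScale E n u l ^ 2 := by
  set S := gridMax Λ (sigmaSq E t₀ F) l with hS
  have hS0 : 0 ≤ S := gridMax_sigmaSq_nonneg h2 t₀ F hΛ.finite hl
  have hdev : ∀ m ∈ Λ, m ≤ l → |sigmaTildeSq E t₀ y m - sigmaSq E t₀ F m| ≤
      2 * devScale E n u l * √S + 2 / 3 * devScale E n u l ^ 2 := by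
    intro m hm hml
    have hm0 : 0 ≤ m := zero_le_one.trans (hΛ.one_le m hm)
    have hd := devScale_nonneg h1 h2 n u hm0
    have hdm := devScale_mono h1 h2 n u hm0 hml
    have hd' := hd.trans hdm
    have hs : sigmaSq E t₀ F m ≤ S := le_gridMax hΛ.finite hm hml
    exact (hy m hm).2.trans (by gcongr)
  rw [Real.sq_sqrt hS0, abs_le]
  constructor
  · obtain ⟨m, hm, hml, h⟩ := exists_gridMax_eq (g := sigmaSq E t₀ F) hΛ.finite hl
    have h3 := (abs_le.1 (hdev m hm hml)).1
    have h4 : sigmaTildeSq E t₀ y m ≤ gridMax Λ (sigmaTildeSq E t₀ y) l :=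
      le_gridMax hΛ.finite hm hml
    rw [← h, ← hS] at h3
    linarith
  · obtain ⟨m, hm, hml, h⟩ := exists_gridMax_eq (g := sigmaTildeSq E t₀ y) hΛ.finite hl
    have h3 := (abs_le.1 (hdev m hm hml)).2
    have h4 : sigmaSq E t₀ F m ≤ S := le_gridMax hΛ.finite hm hml
    rw [h]
    linarith

/-- Stochastic error plus bias. The oracle threshold is twice the bias bound, so the bias takes at
most $v_l/2$. -/
lemma abs_cdfEst_sub_le [IsProbabilityMeasure E.law] (h1 : E.OrdinarySmooth) (h2 : E.LocalBound)
    (hN : 1 ≤ N) (hε₀ : 0 < ε) (hε : ε < 1 / 2) (hΛ : IsLacunary Λ) {α L : ℝ} (hα : 0 < α)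
    (hL : 0 < L) (hF : F ∈ sobolevClass α L) {u lo l : ℝ}
    (hlo : IsOracle E n N ε t₀ Λ α L F lo) (hl : l ∈ Λ) (hlol : lo ≤ l)
    (hy : IsGood E t₀ u F l y) :
    |cdfEst E t₀ l y - cdf F t₀| ≤
      (√u * (√2 * √(gridMax Λ (sigmaSq E t₀ F) l) + 2 / 3 * devScale E n u l) +
        vOracle E n N ε t₀ Λ F l / 2) * (√(n : ℝ))⁻¹ := by
  have hlo1 := hΛ.one_le lo hlo.1.1
  have hl1 := hΛ.one_le l hl
  have hb : √2 * (√Real.pi)⁻¹ * L * l ^ (-α - 1 / 2) ≤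
      vOracle E n N ε t₀ Λ F l / 2 * (√(n : ℝ))⁻¹ := by
    have hv := vOracle_mono (n := n) (t₀ := t₀) (F := F) h1.1 hN hε₀ hε hΛ hlo.1.1 hlol
    have hp : l ^ (-α - 1 / 2) ≤ lo ^ (-α - 1 / 2) :=
      Real.rpow_le_rpow_of_nonpos (by linarith) hlol (by linarith)
    calc _ ≤ √2 * (√Real.pi)⁻¹ * L * lo ^ (-α - 1 / 2) := by gcongr
      _ ≤ vOracle E n N ε t₀ Λ F lo / 2 * (√(n : ℝ))⁻¹ := by linarith [hlo.1.2]
      _ ≤ _ := by gcongr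
  have hs : sigmaSq E t₀ F l ≤ gridMax Λ (sigmaSq E t₀ F) l := le_gridMax hΛ.finite hl le_rfl
  rw [add_mul]
  refine (abs_sub_le _ (1 / 2 - ∫ y, score E t₀ l y ∂(obsLaw E F)) _).trans (add_le_add ?_ ?_)
  · exact hy.1.trans (by gcongr)
  · exact (abs_cdf_sub_le h1 h2 hα hL hF t₀ hl1).trans hb

lemma vartheta_eq (N : ℕ) (ε : ℝ) :
    vartheta N ε = √2 * (√2 - 1)⁻¹ * (1 + √3 * √(Real.log (4 * N / ε))) := by
  rw [vartheta, Real.sqrt_mul (by norm_num)]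

theorem abs_adaptiveEst_sub_le [IsProbabilityMeasure E.law] (h1 : E.OrdinarySmooth)
    (h2 : E.LocalBound) (hβ : 1 / 2 < E.β) (hN : 1 ≤ N) (hε₀ : 0 < ε)
    (hε : ε < 1 / 2) (hΛ : IsLacunary Λ) {α L : ℝ} (hα : 0 < α) (hL : 0 < L)
    (hF : F ∈ sobolevClass α L) {lo : ℝ} (hlo : IsOracle E n N ε t₀ Λ α L F lo)
    (hy : ∀ l ∈ Λ, IsGood E t₀ (Real.log (4 * N / ε)) F l y) :
    |adaptiveEst E N ε t₀ Λ y - cdf F t₀| ≤ riskBound E n N ε t₀ Λ F lo := by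
  set u := Real.log (4 * N / ε) with hu
  set r := (√(n : ℝ))⁻¹ with hr
  have hr0 : 0 ≤ r := by positivity
  have hw : 0 ≤ √u := Real.sqrt_nonneg u
  have hloΛ : lo ∈ Λ := hlo.1.1
  have herr : ∀ l ∈ Λ, lo ≤ l → |cdfEst E t₀ l y - cdf F t₀| ≤
      (1 + √3 * √u) * vOracle E n N ε t₀ Λ F l * r := by
    intro l hl hlol
    have hl0 : 0 ≤ l := zero_le_one.trans (hΛ.one_le l hl)
    refine (abs_cdfEst_sub_le h1 h2 hN hε₀ hε hΛ hα hL hF hlo hl hlol (hy l hl)).trans ?_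
    refine mul_le_mul_of_nonneg_right ?_ hr0
    exact stochastic_error_le (Real.sqrt_nonneg _) (vOracle_pos h2 hN hε₀ hε hΛ hl).le hw
      (devScale_sq_le_penalty hN hε₀ hε hl0) (vOracle_sq h2 hN hε₀ hε hΛ hl)
  have hmem : ∀ l ∈ Λ, lo ≤ l → cdf F t₀ ∈ confInt E N ε t₀ Λ y l := by
    intro l hl hlol
    have hl0 : 0 ≤ l := zero_le_one.trans (hΛ.one_le l hl)
    have h3 := gridMax_sigmaTildeSq_bounds h1 h2 hΛ hy hl
    have h4 : (1 + √3 * √u) * vOracle E n N ε t₀ Λ F l ≤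
        vartheta N ε * vTilde E N ε t₀ Λ y l := by
      rw [vartheta_eq]
      refine le_vartheta_mul_of_sq_ge (Real.sqrt_nonneg _) hw
        (devScale_sq_le_penalty hN hε₀ hε hl0) (vOracle_sq h2 hN hε₀ hε hΛ hl) ?_
      rw [vTilde_sq h2 hN hε₀ hε hΛ hl]
      linarith [(abs_le.1 h3).1]
    have h5 := abs_le.1 ((herr l hl hlol).trans (mul_le_mul_of_nonneg_right h4 hr0))
    constructor <;> linarith [h5.1, h5.2]
  set A := {l | l ∈ Λ ∧ (⋂ μ ∈ {μ | μ ∈ Λ ∧ l ≤ μ}, confInt E N ε t₀ Λ y μ).Nonempty} with hA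
  have hAfin : A.Finite := hΛ.finite.subset fun _ h => h.1
  -- The true value $F(t_0)$ is the common point of all intervals from the oracle on.
  have hloA : lo ∈ A := ⟨hloΛ, cdf F t₀, Set.mem_iInter₂.2 fun m hm => hmem m hm.1 hm.2⟩
  have htA : lamTilde E N ε t₀ Λ y ∈ A := Set.Nonempty.csInf_mem ⟨lo, hloA⟩ hAfin
  have hle : lamTilde E N ε t₀ Λ y ≤ lo := csInf_le hAfin.bddBelow hloA
  have hlo0 : 0 ≤ lo := zero_le_one.trans (hΛ.one_le lo hloΛ)
  have hpen := devScale_sq_le_penalty (E := E) (n := n) hN hε₀ hε hlo0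
  have hv2 := vOracle_sq (n := n) (t₀ := t₀) (F := F) h2 hN hε₀ hε hΛ hloΛ
  have hv := vOracle_pos (n := n) (t₀ := t₀) (F := F) h2 hN hε₀ hε hΛ hloΛ
  unfold adaptiveEst riskBound
  generalize lamTilde E N ε t₀ Λ y = l at *
  obtain ⟨hlΛ, x, hx⟩ := htA
  have hx' : ∀ m ∈ Λ, l ≤ m → x ∈ confInt E N ε t₀ Λ y m :=
    fun m hm hlm => Set.mem_iInter₂.1 hx m ⟨hm, hlm⟩
  rcases hle.eq_or_lt with rfl | hlt
  -- If the oracle itself is selected, its own error bound suffices, the constant being at least 1.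
  · refine (herr l hlΛ le_rfl).trans (mul_le_mul_of_nonneg_right ?_ hr0)
    refine mul_le_mul_of_nonneg_right ?_ hv.le
    rw [vartheta_eq, ← hu, sqrt_two_div_sub_one, ← mul_assoc]
    have h3 : 1 / √2 ≤ 1 := by
      rw [div_le_one (by positivity)]; linarith [sqrt_two_bounds.1]
    have h4 : 1 ≤ (3 - 1 / √2) * (2 + √2) := by nlinarith [sqrt_two_bounds.1]
    exact le_mul_of_one_le_left (by positivity) h4
  · have hl0 : 0 ≤ l := zero_le_one.trans (hΛ.one_le l hlΛ)
    have hl2 := hΛ.two_mul_le l hlΛ lo hloΛ hlt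
    have b1 := (abs_le.1 (gridMax_sigmaTildeSq_bounds h1 h2 hΛ hy hlΛ)).2
    have b2 := (abs_le.1 (gridMax_sigmaTildeSq_bounds h1 h2 hΛ hy hloΛ)).2
    have hp := penalty_le_half (n := n) hβ hN hε₀ hε hl0 hl2
    have hS : √(gridMax Λ (sigmaSq E t₀ F) l) ≤ √(gridMax Λ (sigmaSq E t₀ F) lo) :=
      Real.sqrt_le_sqrt (gridMax_mono hΛ.finite hlΛ hle)
    have hS0 := Real.sqrt_nonneg (gridMax Λ (sigmaSq E t₀ F) l)
    have hd := sqrt_two_mul_devScale_le h1 h2 hβ n u hl0 hl2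
    have hd0 := devScale_nonneg h1 h2 n u hl0
    have hd0' := devScale_nonneg h1 h2 n u hlo0
    have hv1 := vTilde_sq (t₀ := t₀) (y := y) h2 hN hε₀ hε hΛ hlΛ
    have hvlo := vTilde_sq (t₀ := t₀) (y := y) h2 hN hε₀ hε hΛ hloΛ
    have hfin := abs_cdfEst_sub_le h1 h2 hN hε₀ hε hΛ hα hL hF hlo hloΛ le_rfl (hy lo hloΛ)
    have q1 := hx' l hlΛ le_rfl
    have q2 := hx' lo hloΛ hle
    unfold confInt at q1 q2
    rw [Set.mem_Icc, ← hr] at q1 q2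
    have hx2 := Real.mul_self_sqrt (show (0 : ℝ) ≤ 2 by norm_num)
    set d' := devScale E n u l
    set d := devScale E n u lo
    set t' := √(gridMax Λ (sigmaSq E t₀ F) l)
    set t := √(gridMax Λ (sigmaSq E t₀ F) lo)
    -- The deviation scale below the oracle is smaller by $\sqrt2$, as `two_intervals_le` requires
    -- for its first half-width.
    have hdt : 2 * d' * t' ≤ √2 * d * t := by
      calc 2 * d' * t' = √2 * (√2 * d') * t' := by rw [← mul_assoc, hx2]
        _ ≤ √2 * d * t := by gcongr
    have hdd : 2 * d' ^ 2 ≤ d ^ 2 := by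
      have := pow_le_pow_left₀ (by positivity) hd 2
      rwa [mul_pow, Real.sq_sqrt (by norm_num)] at this
    have htt : t' ^ 2 ≤ t ^ 2 := pow_le_pow_left₀ hS0 hS 2
    have key := two_intervals_le (v₁ := vTilde E N ε t₀ Λ y l) (v₂ := vTilde E N ε t₀ Λ y lo)
      (Real.sqrt_nonneg _) hd0' hv hw hpen hv2
      (by rw [hv1]; linarith) (by rw [hvlo]; linarith)
    rw [hu, ← vartheta_eq, ← hu] at key
    have key' := mul_le_mul_of_nonneg_right key hr0
    have hsum : |cdfEst E t₀ l y - cdf F t₀| ≤ vartheta N ε * vTilde E N ε t₀ Λ y l * r +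
        vartheta N ε * vTilde E N ε t₀ Λ y lo * r + |cdfEst E t₀ lo y - cdf F t₀| := by
      have e := abs_sub_le (cdfEst E t₀ l y) (cdfEst E t₀ lo y) (cdf F t₀)
      have e2 : |cdfEst E t₀ l y - cdfEst E t₀ lo y| ≤ vartheta N ε * vTilde E N ε t₀ Λ y l * r +
          vartheta N ε * vTilde E N ε t₀ Λ y lo * r := by
        rw [abs_le]; constructor <;> linarith [q1.1, q1.2, q2.1, q2.2]
      linarith
    linarith

end Confidence

/-! ### From the favourable event to the risk. -/

theorem sampleLaw_riskBound_lt_le [IsProbabilityMeasure E.law] (h1 : E.OrdinarySmooth)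
    (h2 : E.LocalBound) (hβ : 1 / 2 < E.β) (t₀ : ℝ) {n N : ℕ} (hn : 1 ≤ n) (hN : 1 ≤ N) {ε : ℝ}
    (hε₀ : 0 < ε) (hε : ε < 1 / 2) {lam : ℕ → ℝ} (hΛ : IsLacunary (grid N lam)) {α L : ℝ}
    (hα : 0 < α) (hL : 0 < L) {F : Measure ℝ} (hF : F ∈ sobolevClass α L) {lo : ℝ}
    (hlo : IsOracle E n N ε t₀ (grid N lam) α L F lo) {δ : ℝ≥0∞}
    (hδ : ENNReal.ofReal (riskBound E n N ε t₀ (grid N lam) F lo) ≤ δ) :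
    sampleLaw E n F {y | δ < ENNReal.ofReal |adaptiveEst E N ε t₀ (grid N lam) y - cdf F t₀|} ≤
      ENNReal.ofReal ε := by
  have hp : IsProbabilityMeasure F := hF.1
  refine le_trans (measure_mono fun y hy => ?_)
    (sampleLaw_not_isGood_le h1 h2 F t₀ hn hN hΛ.one_le hε₀ (log_level_pos hN hε₀ hε))
  intro hgood
  have hb := abs_adaptiveEst_sub_le h1 h2 hβ hN hε₀ hε hΛ hα hL hF hlo hgood
  exact absurd hy (not_lt.2 ((ENNReal.ofReal_le_ofReal hb).trans hδ))

end Deconv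

theorem theorem2p4 (E : Deconv.ErrorModel) (hprob : IsProbabilityMeasure E.law)
    (hdens : E.law ≪ volume) (hE1 : E.OrdinarySmooth) (hE2 : E.LocalBound)
    (hβ : 1 / 2 < E.β) (t₀ ε : ℝ) (hε₀ : 0 < ε) (hε : ε < 1 / 2)
    (n N : ℕ) (hn : 1 ≤ n) (hN : 1 ≤ N) (lam : ℕ → ℝ) (hmin : 1 ≤ lam 1)
    (hstep : ∀ j : ℕ, 1 ≤ j → j < N → 2 * lam j ≤ lam (j + 1))
    (hmax : lam N = Deconv.lamMax E n N ε)
    (α L : ℝ) (hα : 0 < α) (hL : 0 < L) :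
    -- the bound at each single distribution of the class that has an oracle bandwidth
    (∀ F ∈ Deconv.sobolevClass α L, ∀ lo : ℝ,
      Deconv.IsOracle E n N ε t₀ (Deconv.grid N lam) α L F lo →
      Deconv.epsRisk E t₀ ε
          (Deconv.adaptiveEst (n := n) E N ε t₀ (Deconv.grid N lam)) {F} ≤
        ENNReal.ofReal (Deconv.riskBound E n N ε t₀ (Deconv.grid N lam) F lo)) ∧
    -- the bound on the maximal risk over the class
    (∀ lo : Measure ℝ → ℝ,
      (∀ F ∈ Deconv.sobolevClass α L,
        Deconv.IsOracle E n N ε t₀ (Deconv.grid N lam) α L F (lo F)) →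
      Deconv.epsRisk E t₀ ε
          (Deconv.adaptiveEst (n := n) E N ε t₀ (Deconv.grid N lam))
          (Deconv.sobolevClass α L) ≤
        ⨆ F ∈ Deconv.sobolevClass α L,
          ENNReal.ofReal (Deconv.riskBound E n N ε t₀ (Deconv.grid N lam) F (lo F))) := by
  have hΛ := Deconv.isLacunary_grid hmin hstep
  constructor
  · intro F hF lo hlo
    -- The risk is an infimum, so it suffices that the bound is an admissible $\delta$.
    refine sInf_le ?_
    simp only [Set.mem_ofPred_eq, Set.mem_singleton_iff, iSup_iSup_eq_left]
    exact Deconv.sampleLaw_riskBound_lt_le hE1 hE2 hβ t₀ hn hN hε₀ hε hΛ hα hL hF hlo le_rfl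
  · intro lo hlo
    refine sInf_le ?_
    rw [Set.mem_ofPred_eq]
    refine iSup₂_le fun F hF => ?_
    exact Deconv.sampleLaw_riskBound_lt_le hE1 hE2 hβ t₀ hn hN hε₀ hε hΛ hα hL hF (hlo F hF)
      (le_iSup₂_of_le F hF le_rfl)
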